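/- Let $(W_e)_{e\in\mathbb N}$ be the standard effective listing of the computably enumerable (c.e.) subsets of $\mathbb N$, $W_e$ being the domain of the $e$-th partial computable function. A relation $S\subseteq\mathbb N\times\mathbb N$ is $\Sigma^0_3$ if there is a computable predicate $R$ such that, for all $y,z$, $\; y\,S\,z \iff \exists a\,\forall b\,\exists c\; R(y,z,a,b,c)$. For equivalence relations $E,F$ on $\mathbb N$, say that $E$ is computably reducible to $F$ if there is a one-to-one computable function $g:\mathbb N\to\mathbb N$ such that $x\,E\,y \iff g(x)\,F\,g(y)$ for all $x,y$. A $\Sigma^0_3$ equivalence relation is called $\Sigma^0_3$-complete if every $\Sigma^0_3$ equivalence relation on $\mathbb N$ is computably reducible to it. **Theorem.** For every $\Sigma^0_3$ equivalence relation $S$ on $\mathbb N$ there is a computable function $g:\mathbb N\to\mathbb N$ such that for all $y,z\in\mathbb N$: $$ y\,S\,z \;\Rightarrow\; W_{g(y)}\equiv_1 W_{g(z)}, $$ $$ \neg\, y\,S\,z \;\Rightarrow\; W_{g(y)} \text{ and } W_{g(z)} \text{ are Turing incomparable, i.e. } W_{g(y)}\not\le_T W_{g(z)} \text{ and } W_{g(z)}\not\le_T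 W_{g(y)}. $$ Moreover, the relations $\{(x,y): W_x\equiv_m W_y\}$ and $\{(x,y): W_x\equiv_1 W_y\}$ on $\mathbb N$ (many-one equivalence and one-one equivalence on indices of c.e. sets) are $\Sigma^0_3$-complete equivalence relations. -/

import Mathlib

open scoped Computability

namespace CERel

/-- `W e` is the `e`-th computably enumerable set: the domain of the `e`-th partial computable
function, in the standard numbering of partial computable functions by codes. -/
def W (e : ℕ) : Set ℕ :=
  {n | ((Denumerable.ofNat Nat.Partrec.Code e).eval n).Dom}

open Classical in
/-- The (total) characteristic function of a set of natural numbers. -/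
noncomputable def charFun (A : Set ℕ) : ℕ →. ℕ :=
  fun n => Part.some (if n ∈ A then 1 else 0)

/-- Turing reducibility between sets of natural numbers. -/
def SetTuringReducible (A B : Set ℕ) : Prop :=
  charFun A ≤ᵀ charFun B

/-- Neither set is Turing reducible to the other one. -/
def TuringIncomparable (A B : Set ℕ) : Prop :=
  ¬ SetTuringReducible A B ∧ ¬ SetTuringReducible B A

/-- A binary relation on `ℕ` is `Σ⁰₃`: it has the form `∃ a, ∀ b, ∃ c, R (y, z, a, b, c)` for a
computable (decidable) predicate `R`. -/
def IsSigma03 (S : ℕ → ℕ → Prop) : Prop :=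
  ∃ R : ℕ × ℕ × ℕ × ℕ × ℕ → Prop, ComputablePred R ∧
    ∀ y z, S y z ↔ ∃ a, ∀ b, ∃ c, R (y, z, a, b, c)

/-- `E ≤₁ F` for equivalence relations on `ℕ`: computable reducibility, witnessed by a one-to-one
computable function. -/
def ComputablyReducible (E F : ℕ → ℕ → Prop) : Prop :=
  ∃ g : ℕ → ℕ, Computable g ∧ Function.Injective g ∧ ∀ x y, E x y ↔ F (g x) (g y)

/-- `E` is a `Σ⁰₃` equivalence relation to which each `Σ⁰₃` equivalence relation is
computably reducible. -/
def IsSigma03CompleteEqRel (E : ℕ → ℕ → Prop) : Prop :=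
  Equivalence E ∧ IsSigma03 E ∧
    ∀ S : ℕ → ℕ → Prop, Equivalence S → IsSigma03 S → ComputablyReducible S E

/-- Many-one equivalence of sets of natural numbers. -/
def SetManyOneEquiv (A B : Set ℕ) : Prop :=
  ManyOneEquiv (fun n => n ∈ A) (fun n => n ∈ B)

/-- One-one equivalence of sets of natural numbers. -/
def SetOneOneEquiv (A B : Set ℕ) : Prop :=
  OneOneEquiv (fun n => n ∈ A) (fun n => n ∈ B)

end CERel

/-!
The proof is a priority construction with infinite injury.

Let `S` be a `Σ⁰₃` equivalence relation, so that `S y z` holds if and only if for some `a` the `Π⁰₂`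
condition with index `⟨⟨y, z⟩, a⟩` holds, that is, its confirmation makes unbounded progress. A
finite list of numbers guesses for each `j` below its length either that the condition with index
`j` makes unbounded progress or how much progress it makes. The lists with only correct guesses form
the true path, and there is a primitive recursive sequence of visits to lists in which a list occurs
infinitely often if and only if it is on the true path (`visitNode_of_true`,
`visitNode_of_not_true`). `GuessTree` collects what the construction needs of this.

The requirement of a list of length `⟨e, y, z⟩` is that the program `e` does not enumerate the
complement of the set `A y` from initial segments of `A z`; by the use principle
(`SetTuringReducible.exists_code`) these requirements make `A y` not Turing reducible to `A z`.
When the list is visited and sees such a computation accept a number `x` of its own column, above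
the restraints of higher priority, it enumerates `x` into `A i` for all `i` in the class of `y`
under the equivalence relation generated by its guesses, and restrains all numbers below the
current stage. If the class contains `z`, the list does nothing, and on the true path this happens
only if `S y z`.

Lists with wrong guesses would spoil the agreement of the sets of `S`-equivalent indices. Hence
each visit to a list `n` dumps into all sets the numbers enumerated by the lists of lower priority
that do not extend `n`, as far as the restraints of higher priority permit. Priorities are the codes
of the lists, hence of order type `ω`. Lists off the true path are visited only finitely often. A
list `n` on the true path acts only finitely often (`GuessTree.exists_bound_act`): its visit has
just carried out all the dumping that its predecessors on the true path could later do below its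
restraint, so that the computation it acts on is preserved for good (`GuessTree.frozen`). Thus every
requirement is met (`GuessTree.not_enumerates`). If `S y z`, then some list on the true path has
guessed this, and all numbers but finitely many are dumped or belong to lists sharing this guess,
so that `A y` and `A z` differ at finitely many places (`GuessTree.set_almost_eq`). The sets
`W (g y)` are cylinders over the `A y`, which turns almost equality into one-one equivalence.

Since `g` can be made injective by the `s`-`m`-`n` theorem, and since many-one equivalence implies
Turing equivalence, the same `g` reduces `S` to both equivalence relations on indices; that these
are `Σ⁰₃` is a matter of writing down their definitions with step-bounded computations.
-/

namespace CERel

open Encodable Denumerable Nat.Partrec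

/-! ### Bounded quantifiers and primitive recursive matrices -/

section Bounded

variable {α : Type*} [Primcodable α]

theorem primrecPred_exists_lt {f : α → ℕ} {R : α → ℕ → Prop} (hf : Primrec f)
    (hR : PrimrecPred fun p : α × ℕ => R p.1 p.2) : PrimrecPred fun a => ∃ x < f a, R a x := by
  have h : PrimrecRel fun (x : ℕ) (a : α) => R a x :=
    hR.comp (Primrec.snd.pair Primrec.fst)
  exact (h.exists_mem_list.comp (Primrec.list_range.comp hf) Primrec.id).of_eq (by simp)

theorem primrecPred_forall_lt {f : α → ℕ} {R : α → ℕ → Prop} (hf : Primrec f)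
    (hR : PrimrecPred fun p : α × ℕ => R p.1 p.2) : PrimrecPred fun a => ∀ x < f a, R a x := by
  have h : PrimrecRel fun (x : ℕ) (a : α) => R a x :=
    hR.comp (Primrec.snd.pair Primrec.fst)
  exact (h.forall_mem_list.comp (Primrec.list_range.comp hf) Primrec.id).of_eq (by simp)

theorem primrecPred_imp {p q : α → Prop} (hp : PrimrecPred p) (hq : PrimrecPred q) :
    PrimrecPred fun a => p a → q a :=
  (hp.not.or hq).of_eq fun a => by tauto

end Bounded

/-- The matrix of a `Σ⁰₃` definition can be taken primitive recursive: the innermost existential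
quantifier absorbs the running time of a program deciding the computable matrix. -/
theorem IsSigma03.exists_primrec {S : ℕ → ℕ → Prop} (hS : IsSigma03 S) :
    ∃ R : ℕ → ℕ → ℕ → Prop, (PrimrecPred fun p : ℕ × ℕ × ℕ => R p.1 p.2.1 p.2.2) ∧
      ∀ y z, S y z ↔ ∃ a, ∀ b, ∃ c, R (Nat.pair (Nat.pair y z) a) b c := by
  classical
  obtain ⟨R, hR, hS⟩ := hS
  have hc : Computable fun n : ℕ =>
      decide (R (n.unpair.1.unpair.1.unpair.1, n.unpair.1.unpair.1.unpair.2,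
        n.unpair.1.unpair.2, n.unpair.2.unpair.1, n.unpair.2.unpair.2)) := by
    refine (ComputablePred.decide hR).comp (Primrec.to_comp ?_)
    have h1 : Primrec fun n : ℕ => n.unpair.1 := Primrec.fst.comp Primrec.unpair
    have h2 : Primrec fun n : ℕ => n.unpair.2 := Primrec.snd.comp Primrec.unpair
    exact ((h1.comp (h1.comp h1)).pair ((h2.comp (h1.comp h1)).pair ((h2.comp h1).pair
      ((h1.comp h2).pair (h2.comp h2)))))
  obtain ⟨e, he⟩ := Code.exists_code.1 (Partrec.nat_iff.1
    ((Computable.encode.comp hc).partrec))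
  refine ⟨fun j b c => Code.evaln c.unpair.2 e (Nat.pair j (Nat.pair b c.unpair.1))
    = some (encode true), ?_, fun y z => ?_⟩
  · refine Primrec.eq.comp (Code.primrec_evaln.comp (((Primrec.snd.comp (Primrec.unpair.comp
      (Primrec.snd.comp Primrec.snd))).pair (Primrec.const e)).pair
      (Primrec₂.natPair.comp Primrec.fst (Primrec₂.natPair.comp (Primrec.fst.comp Primrec.snd)
        (Primrec.fst.comp (Primrec.unpair.comp (Primrec.snd.comp Primrec.snd)))))))
      (Primrec.const _)
  · rw [hS]
    refine exists_congr fun a => forall_congr' fun b => ?_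
    have key : ∀ c, R (y, z, a, b, c) ↔
        ∃ k, Code.evaln k e (Nat.pair (Nat.pair (Nat.pair y z) a) (Nat.pair b c))
          = some (encode true) := by
      intro c
      have := @Code.evaln_complete e (Nat.pair (Nat.pair (Nat.pair y z) a) (Nat.pair b c))
        (encode true)
      simp only [Option.mem_def] at this
      rw [← this, he]
      by_cases h : R (y, z, a, b, c) <;> simp [h]
    constructor
    · rintro ⟨c, hc⟩
      obtain ⟨k, hk⟩ := (key c).1 hc
      exact ⟨Nat.pair c k, by simpa using hk⟩
    · rintro ⟨c, hc⟩
      exact ⟨_, (key _).2 ⟨_, hc⟩⟩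

/-- Uniformly c.e. sets have an injective computable sequence of indices. -/
theorem exists_injective_index {P : ℕ → ℕ → ℕ → Prop}
    (hP : PrimrecPred fun p : ℕ × ℕ × ℕ => P p.1 p.2.1 p.2.2) :
    ∃ g : ℕ → ℕ, Computable g ∧ Function.Injective g ∧ ∀ i, W (g i) = {x | ∃ s, P i x s} := by
  classical
  have hf : Partrec fun n : ℕ => Nat.rfind fun s =>
      Part.some (decide (P n.unpair.1 n.unpair.2 s)) := by
    refine Partrec.rfind ?_
    have : Primrec fun p : ℕ × ℕ => decide (P p.1.unpair.1 p.1.unpair.2 p.2) :=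
      hP.decide.comp ((Primrec.fst.comp (Primrec.unpair.comp Primrec.fst)).pair
        ((Primrec.snd.comp (Primrec.unpair.comp Primrec.fst)).pair Primrec.snd))
    exact this.to_comp.partrec
  obtain ⟨c, hc⟩ := Code.exists_code.1 (Partrec.nat_iff.1 hf)
  refine ⟨fun i => encode (Code.curry c i), ?_, ?_, ?_⟩
  · exact (Primrec.encode.comp (Code.primrec₂_curry.comp (Primrec.const c) Primrec.id)).to_comp
  · intro i j h
    exact (Code.curry_inj (encode_injective h)).2
  · intro i
    ext x
    simp only [W, ofNat_encode, Code.eval_curry, hc, Nat.unpair_pair, Set.mem_ofPred_eq]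
    refine Nat.rfind_dom.trans ⟨?_, ?_⟩
    · rintro ⟨s, hs, -⟩
      exact ⟨s, by simpa using hs⟩
    · rintro ⟨s, hs⟩
      exact ⟨s, by simpa using hs, fun _ => trivial⟩

/-! ### The use principle -/

/-- The finite list `σ` of bits is an initial segment of the characteristic function of `B`. -/
def Agrees (σ : List ℕ) (B : ℕ → Prop) : Prop :=
  ∀ i < σ.length, σ.getD i 0 = 1 ∧ B i ∨ σ.getD i 0 = 0 ∧ ¬ B i

open Classical in
/-- The initial segment of length `m` of the characteristic function of `B`. -/
noncomputable def initSeg (B : Set ℕ) (m : ℕ) : List ℕ :=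
  (List.range m).map fun i => if i ∈ B then 1 else 0

theorem agrees_iff {σ : List ℕ} {B : Set ℕ} :
    Agrees σ (· ∈ B) ↔ σ = initSeg B σ.length := by
  classical
  constructor
  · intro h
    refine List.ext_getElem (by simp [initSeg]) fun i h1 h2 => ?_
    have := h i h1
    simp only [List.getD_eq_getElem _ _ h1] at this
    simp only [initSeg, List.getElem_map, List.getElem_range]
    split_ifs with hB <;> tauto
  · intro h i hi
    have : σ.getD i 0 = if i ∈ B then 1 else 0 := by
      rw [h, List.getD_eq_getElem _ _ (by simpa [initSeg] using hi)]
      simp [initSeg]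
    rw [this]
    split_ifs with hB <;> simp [hB]

theorem mem_rfind_map {g : ℕ →. ℕ} {v : ℕ} :
    v ∈ Nat.rfind (fun n => (g n).map fun m => decide (m = 0)) ↔
      0 ∈ g v ∧ ∀ k < v, ∃ w ∈ g k, w ≠ 0 := by
  refine Nat.mem_rfind.trans (and_congr ?_ ⟨fun h k hk => ?_, fun h k hk => ?_⟩)
  · simp
  · simpa using h hk
  · simpa using h k hk

/-- A computation relative to an oracle `B` is the limit of a partial recursive function of initial
segments of `B`. -/
theorem exists_partrec_approx {B : Set ℕ} {f : ℕ →. ℕ} (hf : Nat.RecursiveIn {charFun B} f) :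
    ∃ F : List ℕ → ℕ →. ℕ, Partrec₂ F ∧
      (∀ m m' x v, m ≤ m' → v ∈ F (initSeg B m) x → v ∈ F (initSeg B m') x) ∧
      ∀ x v, v ∈ f x ↔ ∃ m, v ∈ F (initSeg B m) x := by
  classical
  have base : ∀ h : ℕ →. ℕ, Nat.Partrec h → ∃ F : List ℕ → ℕ →. ℕ, Partrec₂ F ∧
      (∀ m m' x v, m ≤ m' → v ∈ F (initSeg B m) x → v ∈ F (initSeg B m') x) ∧
      ∀ x v, v ∈ h x ↔ ∃ m, v ∈ F (initSeg B m) x := fun h hh =>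
    ⟨fun _ x => h x, (Partrec.nat_iff.2 hh).comp Computable.snd, fun _ _ _ _ _ => id, by simp⟩
  induction hf with
  | zero => exact base _ Nat.Partrec.zero
  | succ => exact base _ Nat.Partrec.succ
  | left => exact base _ Nat.Partrec.left
  | right => exact base _ Nat.Partrec.right
  | oracle g hg =>
    rw [Set.mem_singleton_iff] at hg
    subst hg
    refine ⟨fun σ x => Part.ofOption (σ[x]?), ?_, ?_, ?_⟩
    · exact Computable.list_getElem?.ofOption
    · intro m m' x v hm
      simp only [initSeg, Part.mem_ofOption, List.getElem?_map, Option.mem_def,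
        Option.map_eq_some_iff, List.getElem?_eq_some_iff]
      rintro ⟨a, ⟨h, rfl⟩, rfl⟩
      refine ⟨x, ⟨by simp at h ⊢; omega, by simp⟩, by simp⟩
    · intro x v
      simp only [initSeg, Part.mem_ofOption, List.getElem?_map, Option.mem_def,
        Option.map_eq_some_iff, List.getElem?_eq_some_iff, charFun, Part.mem_some_iff]
      constructor
      · rintro rfl
        exact ⟨x + 1, x, ⟨by simp, by simp⟩, by simp⟩
      · rintro ⟨m, a, ⟨h, rfl⟩, rfl⟩
        simp
  | @pair f h _ _ ihf ihh =>
    obtain ⟨F, hF, mF, eF⟩ := ihf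
    obtain ⟨H, hH, mH, eH⟩ := ihh
    refine ⟨fun σ x => (F σ x).bind fun u => (H σ x).map fun w => Nat.pair u w, ?_, ?_, ?_⟩
    · refine Partrec.bind hF (Partrec.map
      (hH.comp (Computable.fst.comp Computable.fst) (Computable.snd.comp Computable.fst)) ?_)
      exact (Primrec₂.natPair.comp (Primrec.snd.comp Primrec.fst) Primrec.snd).to_comp
    · intro m m' x v hm
      simp only [Part.mem_bind_iff, Part.mem_map_iff]
      rintro ⟨u, hu, w, hw, rfl⟩
      exact ⟨u, mF _ _ _ _ hm hu, w, mH _ _ _ _ hm hw, rfl⟩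
    · intro x v
      simp only [Seq.seq, Part.map_eq_map, Part.mem_bind_iff, Part.mem_map_iff,
        exists_exists_and_eq_and]
      constructor
      · rintro ⟨u, hu, w, hw, rfl⟩
        obtain ⟨m, hm⟩ := (eF _ _).1 hu
        obtain ⟨m', hm'⟩ := (eH _ _).1 hw
        exact ⟨max m m', u, mF _ _ _ _ (le_max_left _ _) hm, w,
          mH _ _ _ _ (le_max_right _ _) hm', rfl⟩
      · rintro ⟨m, u, hu, w, hw, rfl⟩
        exact ⟨u, (eF _ _).2 ⟨m, hu⟩, w, (eH _ _).2 ⟨m, hw⟩, rfl⟩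
  | @comp f h _ _ ihf ihh =>
    obtain ⟨F, hF, mF, eF⟩ := ihf
    obtain ⟨H, hH, mH, eH⟩ := ihh
    refine ⟨fun σ x => (H σ x).bind fun u => F σ u, ?_, ?_, ?_⟩
    · exact Partrec.bind hH (hF.comp (Computable.fst.comp Computable.fst) Computable.snd)
    · intro m m' x v hm
      simp only [Part.mem_bind_iff]
      rintro ⟨u, hu, hv⟩
      exact ⟨u, mH _ _ _ _ hm hu, mF _ _ _ _ hm hv⟩
    · intro x v
      refine Part.mem_bind_iff.trans ?_
      simp only [Part.mem_bind_iff]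
      constructor
      · rintro ⟨u, hu, hv⟩
        obtain ⟨m, hm⟩ := (eH _ _).1 hu
        obtain ⟨m', hm'⟩ := (eF _ _).1 hv
        exact ⟨max m m', u, mH _ _ _ _ (le_max_left _ _) hm, mF _ _ _ _ (le_max_right _ _) hm'⟩
      · rintro ⟨m, u, hu, hv⟩
        exact ⟨u, (eH _ _).2 ⟨m, hu⟩, (eF _ _).2 ⟨m, hv⟩⟩
  | @prec f h _ _ ihf ihh =>
    obtain ⟨F, hF, mF, eF⟩ := ihf
    obtain ⟨H, hH, mH, eH⟩ := ihh
    have hmono : ∀ (a n m m' v : ℕ), m ≤ m' →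
        v ∈ (n.rec (F (initSeg B m) a) fun y IH => IH.bind fun i =>
          H (initSeg B m) (Nat.pair a (Nat.pair y i)) : Part ℕ) →
        v ∈ (n.rec (F (initSeg B m') a) fun y IH => IH.bind fun i =>
          H (initSeg B m') (Nat.pair a (Nat.pair y i)) : Part ℕ) := by
      intro a n m m' v hm
      induction n generalizing v with
      | zero => exact mF _ _ _ _ hm
      | succ n ih =>
        simp only [Part.mem_bind_iff]
        rintro ⟨i, hi, hv⟩
        exact ⟨i, ih _ hi, mH _ _ _ _ hm hv⟩
    refine ⟨fun σ p => p.unpair.2.rec (F σ p.unpair.1) fun y IH => IH.bind fun i =>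
      H σ (Nat.pair p.unpair.1 (Nat.pair y i)), ?_, ?_, ?_⟩
    · refine Partrec.nat_rec (Primrec.to_comp (Primrec.snd.comp (Primrec.unpair.comp Primrec.snd)))
        (hF.comp Computable.fst
          (Primrec.to_comp (Primrec.fst.comp (Primrec.unpair.comp Primrec.snd))))
        (h := fun q yi => H q.1 (Nat.pair q.2.unpair.1 (Nat.pair yi.1 yi.2))) ?_
      refine hH.comp (Computable.fst.comp Computable.fst) (Primrec.to_comp ?_)
      exact Primrec₂.natPair.comp (Primrec.fst.comp (Primrec.unpair.comp (Primrec.snd.comp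
        Primrec.fst))) (Primrec₂.natPair.comp (Primrec.fst.comp Primrec.snd)
          (Primrec.snd.comp Primrec.snd))
    · intro m m' x v hm
      exact hmono _ _ _ _ _ hm
    · intro x v
      simp only [Part.bind_eq_bind]
      generalize x.unpair.1 = a
      generalize x.unpair.2 = n
      induction n generalizing v with
      | zero => exact eF _ _
      | succ n ih =>
        simp only [Part.mem_bind_iff]
        constructor
        · rintro ⟨i, hi, hv⟩
          obtain ⟨m, hm⟩ := (ih _).1 hi
          obtain ⟨m', hm'⟩ := (eH _ _).1 hv
          exact ⟨max m m', i, hmono _ _ _ _ _ (le_max_left _ _) hm,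
            mH _ _ _ _ (le_max_right _ _) hm'⟩
        · rintro ⟨m, i, hi, hv⟩
          exact ⟨i, (ih _).2 ⟨m, hi⟩, (eH _ _).2 ⟨m, hv⟩⟩
  | @rfind f _ ihf =>
    obtain ⟨F, hF, mF, eF⟩ := ihf
    have hmem : ∀ σ x v, v ∈ Nat.rfind (fun n => (F σ (Nat.pair x n)).map fun m => decide (m = 0)) ↔
        0 ∈ F σ (Nat.pair x v) ∧ ∀ k < v, ∃ w ∈ F σ (Nat.pair x k), w ≠ 0 :=
      fun _ _ _ => mem_rfind_map
    refine ⟨fun σ x => Nat.rfind fun n => (F σ (Nat.pair x n)).map fun m => decide (m = 0),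
      ?_, ?_, ?_⟩
    · refine Partrec.rfind (Partrec.map (hF.comp (Computable.fst.comp Computable.fst)
        (Primrec.to_comp ?_)) ?_)
      · exact Primrec₂.natPair.comp (Primrec.snd.comp Primrec.fst) Primrec.snd
      · exact Primrec.to_comp (PrimrecPred.decide (Primrec.eq.comp Primrec.snd (Primrec.const 0)))
    · intro m m' x v hm
      simp only [hmem]
      rintro ⟨h0, h⟩
      refine ⟨mF _ _ _ _ hm h0, fun k hk => ?_⟩
      obtain ⟨w, hw, hw0⟩ := h k hk
      exact ⟨w, mF _ _ _ _ hm hw, hw0⟩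
    · intro x v
      refine mem_rfind_map.trans ?_
      simp only [hmem]
      constructor
      · rintro ⟨h0, h⟩
        obtain ⟨m, hm⟩ := (eF _ _).1 h0
        have : ∀ v' ≤ v, ∃ M, ∀ k < v', ∃ w ∈ F (initSeg B M) (Nat.pair x k), w ≠ 0 := by
          intro v' hv'
          induction v' with
          | zero => exact ⟨0, by simp⟩
          | succ v' ih =>
            obtain ⟨M, hM⟩ := ih (by omega)
            obtain ⟨w, hw, hw0⟩ := h v' (by omega)
            obtain ⟨m', hm'⟩ := (eF _ _).1 hw
            refine ⟨max M m', fun k hk => ?_⟩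
            rcases Nat.lt_succ_iff_lt_or_eq.1 hk with hk | rfl
            · obtain ⟨w, hw, hw0⟩ := hM k hk
              exact ⟨w, mF _ _ _ _ (le_max_left _ _) hw, hw0⟩
            · exact ⟨w, mF _ _ _ _ (le_max_right _ _) hm', hw0⟩
        obtain ⟨M, hM⟩ := this v le_rfl
        refine ⟨max m M, mF _ _ _ _ (le_max_left _ _) hm, fun k hk => ?_⟩
        obtain ⟨w, hw, hw0⟩ := hM k hk
        exact ⟨w, mF _ _ _ _ (le_max_right _ _) hw, hw0⟩
      · rintro ⟨m, h0, h⟩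
        refine ⟨(eF _ _).2 ⟨m, h0⟩, fun k hk => ?_⟩
        obtain ⟨w, hw, hw0⟩ := h k hk
        exact ⟨w, (eF _ _).2 ⟨m, hw⟩, hw0⟩

/-- **Use principle.** If `A` is Turing reducible to `B`, then the complement of `A` is c.e. in `B`
through some program `e` acting on initial segments of `B`. -/
theorem SetTuringReducible.exists_code {A B : Set ℕ} (h : SetTuringReducible A B) :
    ∃ e : ℕ, ∀ x, x ∉ A ↔ ∃ p, Agrees (ofNat (List ℕ) p) (· ∈ B) ∧
      0 ∈ (ofNat Code e).eval (Nat.pair p x) := by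
  classical
  obtain ⟨F, hF, -, eF⟩ := exists_partrec_approx (RecursiveIn.iff_nat.1 h)
  have hF' : Partrec fun n : ℕ => F (ofNat (List ℕ) n.unpair.1) n.unpair.2 :=
    hF.comp (Primrec.to_comp ((Primrec.ofNat _).comp (Primrec.fst.comp Primrec.unpair)))
      (Primrec.to_comp (Primrec.snd.comp Primrec.unpair))
  obtain ⟨c, hc⟩ := Code.exists_code.1 (Partrec.nat_iff.1 hF')
  refine ⟨encode c, fun x => ?_⟩
  have h0 : x ∉ A ↔ 0 ∈ charFun A x := by
    by_cases hx : x ∈ A <;> simp [charFun, hx]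
  rw [h0, eF]
  simp only [ofNat_encode, hc, Nat.unpair_pair]
  constructor
  · rintro ⟨m, hm⟩
    refine ⟨encode (initSeg B m), ?_, by simpa using hm⟩
    rw [agrees_iff]
    simp [initSeg]
  · rintro ⟨p, hp, hx⟩
    rw [agrees_iff] at hp
    exact ⟨_, hp ▸ hx⟩

/-! ### The priority construction -/

/-- A tree of guesses about an equivalence relation `S`. The nodes are numbers, read as finite
sequences of guesses: `len n` is the length of the sequence `n`, and `ext n m` says that `m` extends
`n`. Each node `n` claims finitely many pairs to be `S`-equivalent; `rep n` maps a number to a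
representative of its class under the equivalence relation generated by these pairs. The nodes
whose guesses are all correct (`IsTrue`) form the true path; they are exactly the nodes visited
infinitely often. -/
structure GuessTree (S : ℕ → ℕ → Prop) where
  visit : ℕ → ℕ
  len : ℕ → ℕ
  rep : ℕ → ℕ → ℕ
  ext : ℕ → ℕ → Prop
  IsTrue : ℕ → Prop
  visit_primrec : Primrec visit
  len_primrec : Primrec len
  rep_primrec : Primrec₂ rep
  ext_primrec : PrimrecRel ext
  ext_trans : ∀ {n m k}, ext n m → ext m k → ext n k
  ext_of_lt : ∀ {n m}, IsTrue n → IsTrue m → n < m → ext n m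
  visit_true : ∀ {n}, IsTrue n → ∀ N, ∃ s ≥ N, visit s = n
  visit_false : ∀ {n}, ¬ IsTrue n → ∃ N, ∀ s ≥ N, visit s ≠ n
  exists_len : ∀ k, ∃ n, IsTrue n ∧ len n = k
  rep_sound : ∀ {n}, IsTrue n → ∀ i, S i (rep n i)
  exists_rep_eq : ∀ {y z}, S y z → ∃ n, IsTrue n ∧ rep n y = rep n z
  rep_eq_of_ext : ∀ {n m y z}, ext n m → rep n y = rep n z → rep m y = rep m z

namespace GuessTree

variable {S : ℕ → ℕ → Prop} (T : GuessTree S)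

/-- The column of `x`: the only node that may enumerate `x`. -/
def col (x : ℕ) : ℕ := x.unpair.1

/-- The code of the program in the requirement of node `n`. The requirement of a node of length
`⟨e, y, z⟩` is that `e` does not enumerate the complement of the `y`-th set from the `z`-th set. -/
def prog (n : ℕ) : ℕ := (T.len n).unpair.1

/-- The index of the set which node `n` makes hard. -/
def src (n : ℕ) : ℕ := (T.len n).unpair.2.unpair.1

/-- The index of the set which node `n` uses as the oracle. -/
def orc (n : ℕ) : ℕ := (T.len n).unpair.2.unpair.2

/-- Nodes with smaller numbers have higher priority. A run of the construction is recorded by a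
function `a`: `a s = x + 1` if `x` is enumerated at stage `s`, and `a s = 0` if nothing is.
`Acted a x s` says that `x` is enumerated before stage `s`. -/
def Acted (a : ℕ → ℕ) (x s : ℕ) : Prop := ∃ t < s, a t = x + 1

/-- At stage `s` the number `x` is above all restraints of nodes of higher priority than `n`:
a node acting at stage `t` restrains all numbers below `t`. -/
def Above (a : ℕ → ℕ) (n x s : ℕ) : Prop := ∀ t < s, T.visit t < n → a t ≠ 0 → t ≤ x

/-- Before stage `s` the number `x`, already enumerated, is put into all sets: this is done by a
visit to a node of higher priority than the column of `x` which the column of `x` does not extend,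
provided that `x` is above the restraints of still higher priority. -/
def Dumped (a : ℕ → ℕ) (x s : ℕ) : Prop :=
  ∃ u < s, Acted a x u ∧ T.visit u < col x ∧ ¬ T.ext (T.visit u) (col x) ∧
    T.Above a (T.visit u) x u

/-- The number `x` is in the `i`-th set at stage `s`. An enumerated number goes into all sets whose
index is equivalent to `src` according to the guesses of its column, and after dumping into all
sets. The bound `s + 1` on dumping includes the dumping by the visit of stage `s`, which precedes
the action of that stage. -/
def InSet (a : ℕ → ℕ) (i x s : ℕ) : Prop :=
  Acted a x s ∧ (T.rep (col x) i = T.rep (col x) (T.src (col x)) ∨ T.Dumped a x (s + 1))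

/-- With the oracle of stage `s`, the program of node `n` accepts `x` by a computation of length
less than `t`. -/
def Conv (a : ℕ → ℕ) (n x t s : ℕ) : Prop :=
  ∃ p < t, Agrees (ofNat (List ℕ) p) (fun i => T.InSet a (T.orc n) i s) ∧
    Code.evaln t (ofNat Code (T.prog n)) (Nat.pair p x) = some 0

/-- One of the earlier actions of node `n` still witnesses its requirement at stage `s`. -/
def Satisfied (a : ℕ → ℕ) (n s : ℕ) : Prop :=
  ∃ t < s, T.visit t = n ∧ a t ≠ 0 ∧ T.Conv a n (a t - 1) t s

/-- Node `n` may enumerate `x` at stage `s`. -/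
def Elig (a : ℕ → ℕ) (n x s : ℕ) : Prop :=
  T.rep n (T.src n) ≠ T.rep n (T.orc n) ∧ ¬ T.Satisfied a n s ∧ col x = n ∧ ¬ Acted a x s ∧
    T.Above a n x s ∧ T.Conv a n x s s

open Classical in
/-- The action at stage `l.length` on behalf of the node visited then, given the list `l` of the
earlier actions: some `x < l.length` is enumerated, encoded as `x + 1`, unless none is eligible. -/
noncomputable def step (l : List ℕ) : ℕ :=
  Nat.findGreatest (fun w => w ≠ 0 ∧ T.Elig (fun t => l.getD t 0) (T.visit l.length) (w - 1)
    l.length) l.length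

/-- The list of the actions before stage `s`. -/
noncomputable def hist : ℕ → List ℕ
  | 0 => []
  | s + 1 => hist s ++ [T.step (hist s)]

/-- The record of the construction. -/
noncomputable def act (s : ℕ) : ℕ := T.step (T.hist s)

/-- The `i`-th of the constructed sets. -/
def set (i : ℕ) : Set ℕ := {x | ∃ s, T.InSet T.act i x s}

/-! ### The construction is primitive recursive -/

section Primrec

variable {α : Type*} [Primcodable α]

theorem col_primrec : Primrec col := Primrec.fst.comp Primrec.unpair

theorem prog_primrec : Primrec T.prog := Primrec.fst.comp (Primrec.unpair.comp T.len_primrec)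

theorem src_primrec : Primrec T.src :=
  Primrec.fst.comp (Primrec.unpair.comp (Primrec.snd.comp (Primrec.unpair.comp T.len_primrec)))

theorem orc_primrec : Primrec T.orc :=
  Primrec.snd.comp (Primrec.unpair.comp (Primrec.snd.comp (Primrec.unpair.comp T.len_primrec)))

variable {a : α → ℕ → ℕ} {n x t s i : α → ℕ}

theorem acted_primrec (ha : Primrec₂ a) (hx : Primrec x) (hs : Primrec s) :
    PrimrecPred fun p => Acted (a p) (x p) (s p) :=
  primrecPred_exists_lt hs (Primrec.eq.comp (ha.comp Primrec.fst Primrec.snd)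
    (Primrec.succ.comp (hx.comp Primrec.fst)))

theorem above_primrec (ha : Primrec₂ a) (hn : Primrec n) (hx : Primrec x) (hs : Primrec s) :
    PrimrecPred fun p => T.Above (a p) (n p) (x p) (s p) :=
  primrecPred_forall_lt hs <| primrecPred_imp
    (Primrec.nat_lt.comp (T.visit_primrec.comp Primrec.snd) (hn.comp Primrec.fst)) <|
    primrecPred_imp (Primrec.eq.comp (ha.comp Primrec.fst Primrec.snd) (Primrec.const 0)).not
      (Primrec.nat_le.comp Primrec.snd (hx.comp Primrec.fst))

theorem dumped_primrec (ha : Primrec₂ a) (hx : Primrec x) (hs : Primrec s) :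
    PrimrecPred fun p => T.Dumped (a p) (x p) (s p) := by
  have ha' : Primrec₂ fun (p : α × ℕ) t => a p.1 t :=
    ha.comp (Primrec.fst.comp Primrec.fst) Primrec.snd
  have hv : Primrec fun p : α × ℕ => T.visit p.2 := T.visit_primrec.comp Primrec.snd
  have hx' : Primrec fun p : α × ℕ => x p.1 := hx.comp Primrec.fst
  have hc : Primrec fun p : α × ℕ => col (x p.1) := col_primrec.comp hx'
  exact primrecPred_exists_lt hs <| (acted_primrec ha' hx' Primrec.snd).and <|
    (Primrec.nat_lt.comp hv hc).and <| (T.ext_primrec.comp hv hc).not.and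
      (T.above_primrec ha' hv hx' Primrec.snd)

theorem inSet_primrec (ha : Primrec₂ a) (hi : Primrec i) (hx : Primrec x) (hs : Primrec s) :
    PrimrecPred fun p => T.InSet (a p) (i p) (x p) (s p) := by
  have hc : Primrec fun p => col (x p) := col_primrec.comp hx
  exact (acted_primrec ha hx hs).and <| (Primrec.eq.comp (T.rep_primrec.comp hc hi)
    (T.rep_primrec.comp hc (T.src_primrec.comp hc))).or
    (T.dumped_primrec ha hx (Primrec.succ.comp hs))

theorem conv_primrec (ha : Primrec₂ a) (hn : Primrec n) (hx : Primrec x) (ht : Primrec t)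
    (hs : Primrec s) :
    PrimrecPred fun p => T.Conv (a p) (n p) (x p) (t p) (s p) := by
  have h1 : Primrec fun q : (α × ℕ) × ℕ => q.1.1 := Primrec.fst.comp Primrec.fst
  have hl : Primrec fun p : α × ℕ => ofNat (List ℕ) p.2 := (Primrec.ofNat _).comp Primrec.snd
  have hg : Primrec fun q : (α × ℕ) × ℕ => (ofNat (List ℕ) q.1.2).getD q.2 0 :=
    (Primrec.list_getD 0).comp (hl.comp Primrec.fst) Primrec.snd
  have hin : PrimrecPred fun q : (α × ℕ) × ℕ => T.InSet (a q.1.1) (T.orc (n q.1.1)) q.2 (s q.1.1) :=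
    T.inSet_primrec (a := fun q : (α × ℕ) × ℕ => a q.1.1)
      (ha.comp (h1.comp Primrec.fst) Primrec.snd) (T.orc_primrec.comp (hn.comp h1)) Primrec.snd
      (hs.comp h1)
  refine primrecPred_exists_lt ht (PrimrecPred.and (primrecPred_forall_lt
    (Primrec.list_length.comp hl) ?_) ?_)
  · exact ((Primrec.eq.comp hg (Primrec.const 1)).and hin).or
      ((Primrec.eq.comp hg (Primrec.const 0)).and hin.not)
  · exact Primrec.eq.comp (Code.primrec_evaln.comp (((ht.comp Primrec.fst).pair
      ((Primrec.ofNat Code).comp (T.prog_primrec.comp (hn.comp Primrec.fst)))).pair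
      (Primrec₂.natPair.comp Primrec.snd (hx.comp Primrec.fst)))) (Primrec.const _)

theorem satisfied_primrec (ha : Primrec₂ a) (hn : Primrec n) (hs : Primrec s) :
    PrimrecPred fun p => T.Satisfied (a p) (n p) (s p) := by
  have ha' : Primrec₂ fun (p : α × ℕ) t => a p.1 t :=
    ha.comp (Primrec.fst.comp Primrec.fst) Primrec.snd
  have hat : Primrec fun p : α × ℕ => a p.1 p.2 := ha.comp Primrec.fst Primrec.snd
  exact primrecPred_exists_lt hs <|
    (Primrec.eq.comp (T.visit_primrec.comp Primrec.snd) (hn.comp Primrec.fst)).and <|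
    (Primrec.eq.comp hat (Primrec.const 0)).not.and <|
      T.conv_primrec ha' (hn.comp Primrec.fst) (Primrec.pred.comp hat) Primrec.snd
        (hs.comp Primrec.fst)

theorem elig_primrec (ha : Primrec₂ a) (hn : Primrec n) (hx : Primrec x) (hs : Primrec s) :
    PrimrecPred fun p => T.Elig (a p) (n p) (x p) (s p) :=
  (Primrec.eq.comp (T.rep_primrec.comp hn (T.src_primrec.comp hn))
    (T.rep_primrec.comp hn (T.orc_primrec.comp hn))).not.and <|
  (T.satisfied_primrec ha hn hs).not.and <| (Primrec.eq.comp (col_primrec.comp hx) hn).and <|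
  (acted_primrec ha hx hs).not.and <| (T.above_primrec ha hn hx hs).and <|
  T.conv_primrec ha hn hx hs hs

end Primrec

theorem step_primrec : Primrec T.step := by
  classical
  refine Primrec.nat_findGreatest Primrec.list_length ?_
  have hlen : Primrec fun q : List ℕ × ℕ => q.1.length := Primrec.list_length.comp Primrec.fst
  exact (Primrec.eq.comp Primrec.snd (Primrec.const 0)).not.and <|
    T.elig_primrec (a := fun (q : List ℕ × ℕ) t => q.1.getD t 0)
      ((Primrec.list_getD 0).comp (Primrec.fst.comp Primrec.fst) Primrec.snd)
      (T.visit_primrec.comp hlen) (Primrec.pred.comp Primrec.snd) hlen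

theorem act_primrec : Primrec T.act := by
  have h : Primrec fun s => T.hist s := by
    refine (Primrec.nat_rec₁ (f := fun _ l => l ++ [T.step l]) []
      (Primrec.list_concat.comp Primrec.snd (T.step_primrec.comp Primrec.snd))).of_eq fun s => ?_
    induction s with
    | zero => rfl
    | succ s ih => simp only [hist, ← ih]
  exact T.step_primrec.comp h

theorem set_primrec : PrimrecPred fun p : ℕ × ℕ × ℕ => T.InSet T.act p.1 p.2.1 p.2.2 :=
  T.inSet_primrec (a := fun _ => T.act) (T.act_primrec.comp Primrec.snd) Primrec.fst
    (Primrec.fst.comp Primrec.snd) (Primrec.snd.comp Primrec.snd)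

/-! ### The action of a stage -/

section Congr

variable {T} {a b : ℕ → ℕ} {s : ℕ}

theorem acted_congr (h : ∀ t < s, a t = b t) {x u : ℕ} (hu : u ≤ s) :
    Acted a x u ↔ Acted b x u := by
  refine exists_congr fun t => and_congr_right fun ht => ?_
  rw [h t (by omega)]

theorem above_congr (h : ∀ t < s, a t = b t) {n x u : ℕ} (hu : u ≤ s) :
    T.Above a n x u ↔ T.Above b n x u := by
  refine forall₂_congr fun t ht => ?_
  rw [h t (by omega)]

theorem inSet_congr (h : ∀ t < s, a t = b t) {i x : ℕ} : T.InSet a i x s ↔ T.InSet b i x s := by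
  refine and_congr (acted_congr h le_rfl) (or_congr_right (exists_congr fun u =>
    and_congr_right fun hu => ?_))
  rw [acted_congr h (by omega), above_congr h (by omega)]

theorem conv_congr (h : ∀ t < s, a t = b t) {n x t : ℕ} : T.Conv a n x t s ↔ T.Conv b n x t s := by
  have : ∀ i, (fun x => T.InSet a i x s) = fun x => T.InSet b i x s := fun i =>
    funext fun x => propext (inSet_congr h)
  simp only [Conv, this]

theorem elig_congr (h : ∀ t < s, a t = b t) {n x : ℕ} : T.Elig a n x s ↔ T.Elig b n x s := by
  have : T.Satisfied a n s ↔ T.Satisfied b n s := by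
    refine exists_congr fun t => and_congr_right fun ht => ?_
    rw [h t ht, conv_congr h]
  rw [Elig, Elig, this, acted_congr h le_rfl, above_congr h le_rfl, conv_congr h]

end Congr

theorem length_hist (s : ℕ) : (T.hist s).length = s := by
  induction s with
  | zero => rfl
  | succ s ih => simp [hist, ih]

theorem getD_hist {s t : ℕ} (h : t < s) : (T.hist s).getD t 0 = T.act t := by
  induction s with
  | zero => omega
  | succ s ih =>
    rcases Nat.lt_succ_iff_lt_or_eq.1 h with h | rfl
    · rw [← ih h, hist, List.getD_append _ _ _ _ (by rwa [length_hist])]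
    · rw [hist, List.getD_append_right _ _ _ _ (by rw [length_hist])]
      simp [length_hist, act]

theorem elig_hist {n x s : ℕ} :
    T.Elig (fun t => (T.hist s).getD t 0) n x s ↔ T.Elig T.act n x s :=
  elig_congr fun _ ht => T.getD_hist ht

theorem elig_of_act {s x : ℕ} (h : T.act s = x + 1) :
    T.Elig T.act (T.visit s) x s ∧ x < s := by
  classical
  have h1 := Nat.findGreatest_of_ne_zero (m := x + 1) (P := fun w => w ≠ 0 ∧
    T.Elig (fun t => (T.hist s).getD t 0) (T.visit s) (w - 1) s) (n := s)
    (by rw [← h, act, step, length_hist]) (by omega)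
  have h2 : x + 1 ≤ s := by
    rw [← h, act, step, length_hist]
    exact Nat.findGreatest_le s
  exact ⟨T.elig_hist.1 (by simpa using h1.2), h2⟩

theorem not_elig_of_act {s x : ℕ} (h : T.act s = 0) (hx : x < s) :
    ¬ T.Elig T.act (T.visit s) x s := by
  classical
  intro he
  rw [act, step, length_hist, Nat.findGreatest_eq_zero_iff] at h
  exact h (show 0 < x + 1 by omega) hx ⟨by omega, T.elig_hist.2 (by simpa using he)⟩

/-! ### Verification -/

variable {T}

theorem Acted.mono {a : ℕ → ℕ} {x s t : ℕ} (h : Acted a x s) (hst : s ≤ t) : Acted a x t :=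
  let ⟨u, hu, e⟩ := h
  ⟨u, by omega, e⟩

theorem Dumped.mono {a : ℕ → ℕ} {x s t : ℕ} (h : T.Dumped a x s) (hst : s ≤ t) : T.Dumped a x t :=
  let ⟨u, hu, e⟩ := h
  ⟨u, by omega, e⟩

theorem InSet.mono {a : ℕ → ℕ} {i x s t : ℕ} (h : T.InSet a i x s) (hst : s ≤ t) :
    T.InSet a i x t :=
  ⟨h.1.mono hst, h.2.imp_right fun h => h.mono (by omega)⟩

theorem Above.anti {a : ℕ → ℕ} {n x s t : ℕ} (h : T.Above a n x t) (hst : s ≤ t) :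
    T.Above a n x s :=
  fun u hu => h u (by omega)

theorem col_of_act {x t : ℕ} (h : T.act t = x + 1) : col x = T.visit t :=
  (T.elig_of_act h).1.2.2.1

/-- Suppose that from stage `s₀` on no node of higher priority than the true node `n` acts, and only
true ones are visited, and that the dumping below `s₀` is finished by stage `s₁`. If `n` acts at a
later stage `t`, its oracle never changes below `t` afterwards, so that `n` stays satisfied and does
not act again: every number whose dumping by some true node could change the oracle has been dumped
by the visit to `n` at stage `t`. -/
theorem frozen {n s₀ s₁ t : ℕ} (hn : T.IsTrue n)
    (h0 : ∀ s ≥ s₀, T.visit s < n → T.act s = 0 ∧ T.IsTrue (T.visit s))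
    (h1 : ∀ x < s₀, ∀ s, T.Dumped T.act x s → T.Dumped T.act x s₁)
    (ht0 : s₀ ≤ t) (ht1 : s₁ ≤ t) (hv : T.visit t = n) (ha : T.act t ≠ 0) (s : ℕ) (hs : t ≤ s) :
    (∀ u, t < u → u < s → T.visit u = n → T.act u = 0) ∧
      ∀ x < t, T.InSet T.act (T.orc n) x s → T.InSet T.act (T.orc n) x t := by
  obtain ⟨x₀, hx₀⟩ := Nat.exists_eq_succ_of_ne_zero ha
  rw [Nat.succ_eq_add_one] at hx₀
  obtain ⟨⟨hrep, -, hcol, hnew, -, hconv⟩, -⟩ := T.elig_of_act hx₀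
  rw [hv] at hrep hcol hconv
  induction s using Nat.strong_induction_on with
  | _ s ih =>
  have hQ : ∀ u, t < u → u < s → T.visit u = n → T.act u = 0 := by
    intro u htu hus hvu
    by_contra hau
    obtain ⟨x, hx⟩ := Nat.exists_eq_succ_of_ne_zero hau
    have hsat := (T.elig_of_act hx).1.2.1
    refine hsat ⟨t, htu, by rw [hv, hvu], ha, ?_⟩
    rw [hvu, hx₀, Nat.add_sub_cancel]
    obtain ⟨p, hp, hag, hev⟩ := hconv
    refine ⟨p, hp, fun i hi => ?_, hev⟩
    have hit : i < t := by
      have : (ofNat (List ℕ) p).length ≤ encode (ofNat (List ℕ) p) := length_le_encode _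
      rw [encode_ofNat] at this
      omega
    refine (hag i hi).imp (And.imp_right fun h => h.mono htu.le)
      (And.imp_right fun h h' => h ((ih u hus htu.le).2 i hit h'))
  refine ⟨hQ, fun x hxt => ?_⟩
  rintro ⟨⟨t', ht's, hat'⟩, hx⟩
  have hcol' := col_of_act hat'
  obtain ⟨helig', hxt'⟩ := T.elig_of_act hat'
  -- after stage `t` no number below `t` is enumerated
  have ht't : t' ≤ t := by
    by_contra hlt
    push Not at hlt
    rcases lt_trichotomy (T.visit t') n with h | h | h
    · have := (h0 t' (by omega) h).1
      omega
    · have := hQ t' hlt ht's h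
      omega
    · have := helig'.2.2.2.2.1 t hlt (by omega) ha
      omega
  -- a number enumerated by `n` at stage `t` itself goes to the oracle only by being dumped, which
  -- no true node does
  rcases ht't.lt_or_eq with ht't | rfl
  swap
  · obtain rfl : x = x₀ := by omega
    rcases hx with hx | ⟨u, hu, hau, hvu, hext, -⟩
    · rw [hcol] at hx
      exact absurd hx.symm hrep
    · have hut : t' < u := by
        by_contra hle
        exact hnew (hau.mono (by omega))
      rw [hcol] at hvu hext
      exact absurd (T.ext_of_lt (h0 u (by omega) hvu).2 hn hvu) hext
  have hact : Acted T.act x t := ⟨t', ht't, hat'⟩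
  refine ⟨hact, hx.imp_right ?_⟩
  -- if `x` is dumped by a visit at stage `u > t`, then it is dumped already by stage `t`
  rintro ⟨u, hu, hau, hvu, hext, hab⟩
  rcases le_or_gt u t with hut | hut
  · exact ⟨u, by omega, hau, hvu, hext, hab⟩
  rcases lt_trichotomy (T.visit u) n with h | h | h
  · have htrue := (h0 u (by omega) h).2
    have hen := T.ext_of_lt htrue hn h
    rcases lt_or_ge x s₀ with hxs | hxs
    · exact (h1 x hxs (u + 1) ⟨u, by omega, hau, hvu, hext, hab⟩).mono (by omega)
    · have habn : T.Above T.act n x t := by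
        intro t'' _ hvt'' hat''
        by_contra hlt
        exact hat'' (h0 t'' (by omega) hvt'').1
      rcases lt_trichotomy n (col x) with hc | hc | hc
      · refine ⟨t, by omega, hact, by rw [hv]; exact hc, ?_, by rw [hv]; exact habn⟩
        rw [hv]
        exact fun hnx => hext (T.ext_trans hen hnx)
      · exact absurd (hc ▸ hen) hext
      · have := (h0 t' (by omega) (hcol' ▸ hc)).1
        omega
  · rw [h] at hvu hext hab
    exact ⟨t, by omega, hact, by rwa [hv], by rwa [hv], by rw [hv]; exact hab.anti hut.le⟩
  · have := hab t hut (by omega) ha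
    omega

theorem exists_bound_forall_lt {P : ℕ → ℕ → Prop} (m : ℕ) (h : ∀ n < m, ∃ N, ∀ s ≥ N, P n s) :
    ∃ N, ∀ n < m, ∀ s ≥ N, P n s := by
  induction m with
  | zero => exact ⟨0, by simp⟩
  | succ m ih =>
    obtain ⟨N, hN⟩ := ih fun n hn => h n (by omega)
    obtain ⟨M, hM⟩ := h m (by omega)
    refine ⟨max N M, fun n hn s hs => ?_⟩
    rcases Nat.lt_succ_iff_lt_or_eq.1 hn with hn | rfl
    · exact hN n hn s (le_trans (le_max_left _ _) hs)
    · exact hM s (le_trans (le_max_right _ _) hs)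

variable (T)

/-- Each node acts only finitely often. -/
theorem exists_bound_act (n : ℕ) : ∃ N, ∀ s ≥ N, T.visit s = n → T.act s = 0 := by
  induction n using Nat.strong_induction_on with
  | _ n ih =>
  by_cases hn : T.IsTrue n
  swap
  · obtain ⟨N, hN⟩ := T.visit_false hn
    exact ⟨N, fun s hs h => absurd h (hN s hs)⟩
  obtain ⟨s₀, hs₀⟩ := exists_bound_forall_lt
    (P := fun m s => T.visit s = m → T.act s = 0 ∧ T.IsTrue m) n fun m hm => by
      obtain ⟨N, hN⟩ := ih m hm
      by_cases htm : T.IsTrue m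
      · exact ⟨N, fun s hs h => ⟨hN s hs h, htm⟩⟩
      · obtain ⟨N, hN⟩ := T.visit_false htm
        exact ⟨N, fun s hs h => absurd h (hN s hs)⟩
  obtain ⟨s₁, hs₁⟩ := exists_bound_forall_lt
    (P := fun x s => ∀ s', T.Dumped T.act x s' → T.Dumped T.act x s) s₀ fun x _ => by
      by_cases hx : ∃ s, T.Dumped T.act x s
      · obtain ⟨N, hN⟩ := hx
        exact ⟨N, fun s hs _ _ => hN.mono hs⟩
      · exact ⟨0, fun s _ s' hs' => absurd ⟨s', hs'⟩ hx⟩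
  by_contra hcon
  push Not at hcon
  obtain ⟨t, ht, hvt, hat⟩ := hcon (max s₀ s₁)
  obtain ⟨u, hu, hvu, hau⟩ := hcon (t + 1)
  exact hau ((frozen hn (fun s hs h => hs₀ _ h s hs rfl) (fun x hx s => hs₁ x hx s₁ le_rfl s)
    (le_trans (le_max_left _ _) ht) (le_trans (le_max_right _ _) ht) hvt hat (u + 1)
    (by omega)).1 u (by omega) (by omega) hvu)

theorem exists_bound_act_lt (n : ℕ) : ∃ N, ∀ s ≥ N, T.visit s < n → T.act s = 0 := by
  obtain ⟨N, hN⟩ := exists_bound_forall_lt (P := fun m s => T.visit s = m → T.act s = 0) n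
    fun m _ => T.exists_bound_act m
  exact ⟨N, fun s hs h => hN _ h s hs rfl⟩

/-- `S`-equivalent indices have almost equal sets: a number that is never dumped belongs to a column
extending the true node which has learnt the equivalence, up to finitely many exceptions. -/
theorem set_almost_eq {y z : ℕ} (h : S y z) : ∃ N, ∀ x ≥ N, x ∈ T.set y ↔ x ∈ T.set z := by
  obtain ⟨n, hn, hrep⟩ := T.exists_rep_eq h
  obtain ⟨N, hN⟩ := T.exists_bound_act_lt n
  refine ⟨N, fun x hx => ?_⟩
  suffices ∀ y z, T.rep n y = T.rep n z → x ∈ T.set y → x ∈ T.set z from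
    ⟨this y z hrep, this z y hrep.symm⟩
  rintro y z hrep ⟨s, ⟨t, hts, hat⟩, hin⟩
  rcases hin with hin | hin
  swap
  · exact ⟨s, ⟨t, hts, hat⟩, Or.inr hin⟩
  have hcol := col_of_act hat
  have hlt := (T.elig_of_act hat).2
  have hne : n ≤ col x := by
    by_contra hc
    have := hN t (by omega) (by omega)
    omega
  by_cases hext : n = col x ∨ T.ext n (col x)
  · refine ⟨s, ⟨t, hts, hat⟩, Or.inl ?_⟩
    rw [← hin]
    rcases hext with hext | hext
    · rw [← hext, hrep]
    · exact T.rep_eq_of_ext hext hrep.symm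
  · push Not at hext
    obtain ⟨u, hu, hvu⟩ := T.visit_true hn (max s (t + 1))
    refine ⟨u, ⟨t, by omega, hat⟩, Or.inr ⟨u, by omega, ⟨t, by omega, hat⟩, ?_, ?_, ?_⟩⟩
    · rw [hvu]
      exact lt_of_le_of_ne hne hext.1
    · rw [hvu]
      exact hext.2
    · rw [hvu]
      intro t' _ hvt' hat'
      by_contra hlt
      exact hat' (hN t' (by omega) hvt')

/-- If `y` and `z` are not `S`-equivalent, no program enumerates the complement of the `y`-th set
from the `z`-th set. -/
theorem not_enumerates (hS : Equivalence S) {y z : ℕ} (h : ¬ S y z) (e : ℕ) :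
    ¬ ∀ x, x ∉ T.set y ↔ ∃ p, Agrees (ofNat (List ℕ) p) (· ∈ T.set z) ∧
      0 ∈ (ofNat Code e).eval (Nat.pair p x) := by
  intro hall
  obtain ⟨n, hn, hlen⟩ := T.exists_len (Nat.pair e (Nat.pair y z))
  have hprog : T.prog n = e := by simp [prog, hlen]
  have hsrc : T.src n = y := by simp [src, hlen]
  have horc : T.orc n = z := by simp [orc, hlen]
  have hrep : T.rep n y ≠ T.rep n z := fun hr =>
    h (hS.trans (T.rep_sound hn y) (hr ▸ hS.symm (T.rep_sound hn z)))
  obtain ⟨s₀, hs₀⟩ := T.exists_bound_act_lt (n + 1)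
  have settle : ∀ m, ∃ N, ∀ i < m, ∀ s ≥ N, T.InSet T.act z i s ↔ i ∈ T.set z := fun m =>
    exists_bound_forall_lt (P := fun i s => T.InSet T.act z i s ↔ i ∈ T.set z) m fun i _ => by
      by_cases hi : i ∈ T.set z
      · obtain ⟨N, hN⟩ := hi
        exact ⟨N, fun s hs => ⟨fun h => ⟨s, h⟩, fun _ => hN.mono hs⟩⟩
      · exact ⟨0, fun s _ => ⟨fun h => ⟨s, h⟩, fun h => absurd h hi⟩⟩
  -- a number in the column of `n` which is above all restraints and is never enumerated
  set x := Nat.pair n s₀ with hxdef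
  have hxs : s₀ ≤ x := Nat.right_le_pair _ _
  have hcx : col x = n := by simp [col, hxdef]
  have hnot : ∀ s, ¬ Acted T.act x s := by
    rintro s ⟨t, -, hat⟩
    have h1 := col_of_act hat
    have h2 := (T.elig_of_act hat).2
    have h3 := hs₀ t (by omega) (by omega)
    omega
  obtain ⟨p, hag, hp⟩ := (hall x).1 fun ⟨s, hs⟩ => hnot s hs.1
  obtain ⟨k, hk⟩ := Code.evaln_complete.1 hp
  obtain ⟨N₁, hN₁⟩ := settle (ofNat (List ℕ) p).length
  obtain ⟨N₂, hN₂⟩ := settle s₀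
  obtain ⟨s, hs, hvs⟩ := T.visit_true hn (N₁ + N₂ + k + p + x + 1)
  have hact : T.act s = 0 := hs₀ s (by omega) (by omega)
  refine T.not_elig_of_act hact (show x < s by omega) ?_
  rw [hvs]
  refine ⟨by rwa [hsrc, horc], ?_, hcx, hnot s, ?_, p, by omega, ?_, ?_⟩
  · -- a witness found before stage `s₀` that still looks good is good, as the oracle is settled
    rintro ⟨t, hts, hvt, hat, q, hq, hagq, hevq⟩
    obtain ⟨x', hx'⟩ := Nat.exists_eq_succ_of_ne_zero hat
    rw [Nat.succ_eq_add_one] at hx'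
    rw [hx', Nat.add_sub_cancel, hprog] at hevq
    have hts₀ : t < s₀ := by
      by_contra hle
      exact hat (hs₀ t (by omega) (by omega))
    refine (hall x').2 ⟨q, fun i hi => ?_, Code.evaln_sound hevq⟩ ⟨t + 1, ⟨t, by omega, hx'⟩, ?_⟩
    · have hlen' : (ofNat (List ℕ) q).length ≤ encode (ofNat (List ℕ) q) := length_le_encode _
      rw [encode_ofNat] at hlen'
      have := hagq i hi
      simp only [horc, hN₂ i (by omega) s (by omega)] at this
      exact this
    · left
      rw [col_of_act hx', hvt, hsrc]
  · intro t _ hvt hat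
    by_contra hlt
    exact hat (hs₀ t (by omega) (by omega))
  · intro i hi
    have := hag i hi
    simp only [horc, hN₁ i hi s (by omega)]
    exact this
  · rw [hprog]
    exact Code.evaln_mono (by omega) hk

end GuessTree

/-! ### Merging classes along a list of guesses -/

/-- Applies the substitutions `p.1 ↦ p.2` of a list one after the other, from the last entry of the
list to the first. -/
def applySubst (l : List (ℕ × ℕ)) (i : ℕ) : ℕ :=
  l.foldr (fun p i => if i = p.1 then p.2 else i) i

/-- Processes the guess `c` about the index `j = l.length` of the pair `(y, z)` coded by
`j.unpair.1`: if `c = 0`, the representative of `z` is replaced by that of `y`. Otherwise the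
trivial substitution is added, which keeps track of `j`. -/
def substStep (l : List (ℕ × ℕ)) (c : ℕ) : List (ℕ × ℕ) :=
  (if c = 0 then (applySubst l l.length.unpair.1.unpair.2, applySubst l l.length.unpair.1.unpair.1)
    else (0, 0)) :: l

/-- The list of substitutions resulting from a list of guesses. -/
def substs (l : List ℕ) : List (ℕ × ℕ) := l.foldl substStep []

theorem applySubst_primrec : Primrec₂ applySubst := by
  refine Primrec.list_foldr (f := fun p : List (ℕ × ℕ) × ℕ => p.1) (g := fun p => p.2)
    (h := fun _ q => if q.2 = q.1.1 then q.1.2 else q.2) Primrec.fst Primrec.snd ?_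
  have h1 : Primrec fun r : (List (ℕ × ℕ) × ℕ) × (ℕ × ℕ) × ℕ => r.2.1 :=
    Primrec.fst.comp Primrec.snd
  have h2 : Primrec fun r : (List (ℕ × ℕ) × ℕ) × (ℕ × ℕ) × ℕ => r.2.2 :=
    Primrec.snd.comp Primrec.snd
  exact Primrec.ite (Primrec.eq.comp h2 (Primrec.fst.comp h1)) (Primrec.snd.comp h1) h2

theorem substs_primrec : Primrec substs := by
  refine Primrec.list_foldl (f := fun l : List ℕ => l) (g := fun _ => [])
    (h := fun _ q => substStep q.1 q.2) Primrec.id (Primrec.const _) ?_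
  have hl : Primrec fun r : List ℕ × List (ℕ × ℕ) × ℕ => r.2.1 := Primrec.fst.comp Primrec.snd
  have hp : Primrec fun r : List ℕ × List (ℕ × ℕ) × ℕ => r.2.1.length.unpair.1.unpair :=
    Primrec.unpair.comp (Primrec.fst.comp (Primrec.unpair.comp (Primrec.list_length.comp hl)))
  exact Primrec.list_cons.comp (Primrec.ite
    (Primrec.eq.comp (Primrec.snd.comp Primrec.snd) (Primrec.const 0))
    ((applySubst_primrec.comp hl (Primrec.snd.comp hp)).pair
      (applySubst_primrec.comp hl (Primrec.fst.comp hp))) (Primrec.const _)) hl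

theorem substs_concat (l : List ℕ) (c : ℕ) : substs (l ++ [c]) = substStep (substs l) c := by
  simp [substs]

theorem length_substs (l : List ℕ) : (substs l).length = l.length := by
  induction l using List.reverseRecOn with
  | nil => rfl
  | append_singleton l c ih => simp [substs_concat, substStep, ih]

theorem suffix_substs_append (l r : List ℕ) : ∃ t, substs (l ++ r) = t ++ substs l := by
  induction r using List.reverseRecOn with
  | nil => exact ⟨[], by simp⟩
  | append_singleton r c ih =>
    obtain ⟨t, ht⟩ := ih
    rw [← List.append_assoc, substs_concat, ht, substStep]
    exact ⟨_ :: t, rfl⟩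

theorem applySubst_substs_of_prefix {l m : List ℕ} (h : l <+: m) {y z : ℕ}
    (hl : applySubst (substs l) y = applySubst (substs l) z) :
    applySubst (substs m) y = applySubst (substs m) z := by
  obtain ⟨r, rfl⟩ := h
  obtain ⟨t, ht⟩ := suffix_substs_append l r
  rw [ht]
  simp only [applySubst, List.foldr_append] at hl ⊢
  rw [hl]

theorem applySubst_cons (p : ℕ × ℕ) (l : List (ℕ × ℕ)) (i : ℕ) :
    applySubst (p :: l) i = if applySubst l i = p.1 then p.2 else applySubst l i := rfl

/-- A guess `0` at position `⟨⟨y, z⟩, a⟩` merges the classes of `y` and `z`. -/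
theorem applySubst_merge {l : List ℕ} {y z a : ℕ} (hl : l.length = Nat.pair (Nat.pair y z) a) :
    applySubst (substs (l ++ [0])) y = applySubst (substs (l ++ [0])) z := by
  simp only [substs_concat, substStep, length_substs, hl, Nat.unpair_pair, applySubst_cons, if_true]
  split_ifs <;> rfl

/-- If all merged pairs are equivalent, each number is equivalent to its representative. -/
theorem applySubst_sound {S : ℕ → ℕ → Prop} (hS : Equivalence S) (l : List ℕ)
    (hl : ∀ j (hj : j < l.length), l[j] = 0 → S j.unpair.1.unpair.1 j.unpair.1.unpair.2) (i : ℕ) :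
    S i (applySubst (substs l) i) := by
  induction l using List.reverseRecOn generalizing i with
  | nil => exact hS.refl i
  | append_singleton l c ih =>
    have ih' := ih fun j hj h0 => hl j (by simp; omega) (by rwa [List.getElem_append_left hj])
    rw [substs_concat, substStep, applySubst_cons, length_substs]
    by_cases hc : c = 0
    · have hj := hl l.length (by simp) (by simpa using hc)
      simp only [hc, if_true]
      split_ifs with he
      · exact hS.trans (ih' i) (he ▸ hS.trans (hS.symm (ih' _)) (hS.trans (hS.symm hj) (ih' _)))
      · exact ih' i
    · simp only [hc, if_false]
      split_ifs with he
      · exact he ▸ ih' i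
      · exact ih' i

theorem pair_le_pair {a b c d : ℕ} (h : a ≤ b) (h' : c ≤ d) : Nat.pair a c ≤ Nat.pair b d :=
  le_trans ((StrictMono.monotone fun _ _ => Nat.pair_lt_pair_left c) h)
    ((StrictMono.monotone fun _ _ => Nat.pair_lt_pair_right b) h')

theorem encode_le_encode_append (l r : List ℕ) : encode l ≤ encode (l ++ r) := by
  induction l with
  | nil => simp
  | cons a l ih =>
    rw [List.cons_append, encode_list_cons, encode_list_cons]
    exact Nat.succ_le_succ (pair_le_pair le_rfl ih)

/-! ### The tree of guesses about a `Σ⁰₃` relation -/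

section Guesses

variable (R : ℕ → ℕ → ℕ → Prop)

/-- `Progress R j w u` says that at stage `u` the condition `∀ b, ∃ c, R j b c` has been confirmed
for all `b < w`. -/
def Progress (j w u : ℕ) : Prop := ∀ b < w, ∃ c < u, R j b c

/-- At stage `u` all positions where the list `l` has the entry `0` have progressed to `w`. -/
def Grown (l : List ℕ) (w u : ℕ) : Prop :=
  w ≤ u ∧ ∀ j < l.length, l.getD j 0 = 0 → Progress R j w u

/-- `Visits R l w u` says that `l` is visited for the `w`-th time, which happens at stage `u`. An
entry `0` of `l` at position `j` guesses that the progress of `j` is unbounded, and an entry `c + 1`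
that it is exactly `c`. The stage `u` is the first one at which all the positions guessed to be
unbounded have progressed to `w`; the other guesses have to look correct at stage `u`. -/
def Visits (l : List ℕ) (w u : ℕ) : Prop :=
  Grown R l w u ∧ (∀ u' < u, ¬ Grown R l w u') ∧
    ∀ j < l.length, l.getD j 0 ≠ 0 →
      Progress R j (l.getD j 0 - 1) u ∧ ¬ Progress R j (l.getD j 0) u

open Classical in
/-- The node visited at stage `s`; the node `0`, which is the empty list, serves as a default. -/
noncomputable def visitNode (s : ℕ) : ℕ :=
  if Visits R (ofNat (List ℕ) s.unpair.1) s.unpair.2.unpair.1 s.unpair.2.unpair.2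
  then s.unpair.1 else 0

open Classical in
/-- The correct guess at position `j`. -/
noncomputable def trueGuess (j : ℕ) : ℕ :=
  if h : ∃ w, ∀ u, ¬ Progress R j w u then Nat.find h else 0

/-- A node is true if all its guesses are correct. -/
def TrueNode (n : ℕ) : Prop :=
  ofNat (List ℕ) n = (List.range (ofNat (List ℕ) n).length).map (trueGuess R)

variable {R}

theorem Progress.mono {j w u w' u' : ℕ} (h : Progress R j w u) (hw : w' ≤ w) (hu : u ≤ u') :
    Progress R j w' u' := fun b hb =>
  let ⟨c, hc, hR⟩ := h b (by omega)
  ⟨c, by omega, hR⟩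

theorem trueGuess_eq_zero_iff {j : ℕ} : trueGuess R j = 0 ↔ ∀ w, ∃ u, Progress R j w u := by
  classical
  unfold trueGuess
  split_ifs with h
  · rw [Nat.find_eq_zero]
    refine ⟨fun h0 => absurd (fun b hb => by omega) (h0 0), fun h' => ?_⟩
    obtain ⟨w, hw⟩ := h
    obtain ⟨u, hu⟩ := h' w
    exact absurd hu (hw u)
  · push Not at h
    exact ⟨fun _ => h, fun _ => rfl⟩

theorem forall_exists_progress_iff {j : ℕ} :
    (∀ w, ∃ u, Progress R j w u) ↔ ∀ b, ∃ c, R j b c := by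
  constructor
  · intro h b
    obtain ⟨u, hu⟩ := h (b + 1)
    obtain ⟨c, -, hc⟩ := hu b (by omega)
    exact ⟨c, hc⟩
  · intro h w
    induction w with
    | zero => exact ⟨0, fun b hb => by omega⟩
    | succ w ih =>
      obtain ⟨u, hu⟩ := ih
      obtain ⟨c, hc⟩ := h w
      refine ⟨max u (c + 1), fun b hb => ?_⟩
      rcases Nat.lt_succ_iff_lt_or_eq.1 hb with hb | rfl
      · obtain ⟨c', hc', hR⟩ := hu b hb
        exact ⟨c', lt_of_lt_of_le hc' (le_max_left _ _), hR⟩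
      · exact ⟨c, lt_of_lt_of_le (Nat.lt_succ_self c) (le_max_right _ _), hc⟩

/-- A finite guess is correct if and only if it looks correct at almost all stages, and otherwise it
looks wrong at almost all stages. -/
theorem exists_progress_bound {j c : ℕ} (hc : c ≠ 0) :
    ∃ N, ∀ u ≥ N, (Progress R j (c - 1) u ∧ ¬ Progress R j c u) ↔ c = trueGuess R j := by
  classical
  by_cases h : ∃ w, ∀ u, ¬ Progress R j w u
  · have htg : trueGuess R j = Nat.find h := dif_pos h
    have hspec := Nat.find_spec h
    rw [htg]
    rcases lt_trichotomy c (Nat.find h) with hlt | heq | hgt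
    · have := Nat.find_min h hlt
      push Not at this
      obtain ⟨N, hN⟩ := this
      exact ⟨N, fun u hu => ⟨fun h' => absurd (hN.mono le_rfl hu) h'.2, fun h' => by omega⟩⟩
    · have := Nat.find_min h (m := c - 1) (by omega)
      push Not at this
      obtain ⟨N, hN⟩ := this
      exact ⟨N, fun u hu => ⟨fun _ => heq, fun _ => ⟨hN.mono le_rfl hu, heq ▸ hspec u⟩⟩⟩
    · exact ⟨0, fun u _ => ⟨fun h' => absurd (h'.1.mono (by omega) le_rfl) (hspec u),
        fun h' => by omega⟩⟩
  · have htg : trueGuess R j = 0 := dif_neg h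
    push Not at h
    obtain ⟨N, hN⟩ := h c
    exact ⟨N, fun u hu => ⟨fun h' => absurd (hN.mono le_rfl hu) h'.2, fun h' => by omega⟩⟩

theorem trueNode_iff {n : ℕ} : TrueNode R n ↔
    ∀ j < (ofNat (List ℕ) n).length, (ofNat (List ℕ) n).getD j 0 = trueGuess R j := by
  constructor
  · intro h j hj
    rw [h, List.getD_eq_getElem _ _ (by simpa using hj)]
    simp
  · intro h
    refine List.ext_getElem (by simp) fun j h1 _ => ?_
    rw [← List.getD_eq_getElem _ 0 h1, h j h1]
    simp

theorem visitNode_of_true {n : ℕ} (hn : TrueNode R n) (N : ℕ) : ∃ s ≥ N, visitNode R s = n := by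
  classical
  rw [trueNode_iff] at hn
  set l := ofNat (List ℕ) n with hl
  obtain ⟨M, hM⟩ := GuessTree.exists_bound_forall_lt (P := fun j u => l.getD j 0 ≠ 0 →
      Progress R j (l.getD j 0 - 1) u ∧ ¬ Progress R j (l.getD j 0) u) l.length fun j hj => by
    by_cases h0 : l.getD j 0 = 0
    · exact ⟨0, fun _ _ h => absurd h0 h⟩
    · obtain ⟨M, hM⟩ := exists_progress_bound (R := R) (j := j) h0
      exact ⟨M, fun u hu _ => (hM u hu).2 (hn j hj)⟩
  have hex : ∃ u, Grown R l (M + N) u := by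
    obtain ⟨K, hK⟩ := GuessTree.exists_bound_forall_lt (P := fun j u => l.getD j 0 = 0 →
        Progress R j (M + N) u) l.length fun j hj => by
      by_cases h0 : l.getD j 0 = 0
      · obtain ⟨u, hu⟩ := trueGuess_eq_zero_iff.1 ((hn j hj).symm.trans h0) (M + N)
        exact ⟨u, fun _ hs _ => hu.mono le_rfl hs⟩
      · exact ⟨0, fun _ _ h => absurd h h0⟩
    exact ⟨max K (M + N), le_max_right _ _, fun j hj h0 => hK j hj _ (le_max_left _ _) h0⟩
  have hspec := Nat.find_spec hex
  refine ⟨Nat.pair n (Nat.pair (M + N) (Nat.find hex)), ?_, ?_⟩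
  · calc N ≤ M + N := Nat.le_add_left _ _
      _ ≤ _ := Nat.left_le_pair _ _
      _ ≤ _ := Nat.right_le_pair _ _
  · simp only [visitNode, Nat.unpair_pair]
    refine if_pos ⟨hspec, fun u' hu' => Nat.find_min hex hu', fun j hj h0 => hM j hj _ ?_ h0⟩
    have := hspec.1
    omega

theorem exists_visits_bound {n : ℕ} (hn : ¬ TrueNode R n) :
    ∃ N, ∀ w u, Visits R (ofNat (List ℕ) n) w u → w ≤ N ∧ u ≤ N := by
  classical
  simp only [trueNode_iff, not_forall] at hn
  set l := ofNat (List ℕ) n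
  obtain ⟨j, hj, hne⟩ := hn
  by_cases h0 : l.getD j 0 = 0
  · rw [h0] at hne
    have h := mt trueGuess_eq_zero_iff.2 (Ne.symm hne)
    push Not at h
    obtain ⟨w₀, hw₀⟩ := h
    -- for each of the finitely many possible `w`, the stage of the visit is unique
    have : ∀ w, ∃ M, ∀ u, Visits R l w u → u ≤ M := fun w => by
      by_cases hex : ∃ u, Visits R l w u
      · obtain ⟨u, hu⟩ := hex
        exact ⟨u, fun u' hu' => not_lt.1 fun hlt => hu'.2.1 u hlt hu.1⟩
      · exact ⟨0, fun u hu => absurd ⟨u, hu⟩ hex⟩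
    choose M hM using this
    refine ⟨w₀ + (Finset.range w₀).sup M, fun w u hwu => ?_⟩
    have hw : w < w₀ := by
      by_contra hle
      exact hw₀ u ((hwu.1.2 j hj h0).mono (by omega) le_rfl)
    have := Finset.le_sup (f := M) (Finset.mem_range.2 hw)
    have := hM w u hwu
    omega
  · obtain ⟨N, hN⟩ := exists_progress_bound (R := R) (j := j) h0
    refine ⟨N, fun w u hwu => ?_⟩
    have hu : u < N := by
      by_contra hle
      exact hne ((hN u (by omega)).1 (hwu.2.2 j hj h0))
    have := hwu.1.1
    omega

theorem visitNode_of_not_true {n : ℕ} (hn : ¬ TrueNode R n) :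
    ∃ N, ∀ s ≥ N, visitNode R s ≠ n := by
  classical
  obtain ⟨N, hN⟩ := exists_visits_bound hn
  refine ⟨Nat.pair n (Nat.pair N N) + 1, fun s hs h => ?_⟩
  have hn0 : n ≠ 0 := by
    rintro rfl
    exact hn (trueNode_iff.2 (by simp))
  unfold visitNode at h
  split_ifs at h with hv
  · obtain ⟨h1, h2⟩ := hN _ _ (h ▸ hv)
    have : s ≤ Nat.pair n (Nat.pair N N) := by
      rw [← Nat.pair_unpair s, h, ← Nat.pair_unpair s.unpair.2]
      exact pair_le_pair le_rfl (pair_le_pair h1 h2)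
    omega
  · exact hn0 h.symm

theorem visitNode_primrec (hR : PrimrecPred fun p : ℕ × ℕ × ℕ => R p.1 p.2.1 p.2.2) :
    Primrec (visitNode R) := by
  classical
  have hprog : ∀ {α : Type} [Primcodable α] {j w u : α → ℕ}, Primrec j → Primrec w → Primrec u →
      PrimrecPred fun p => Progress R (j p) (w p) (u p) := fun hj hw hu =>
    primrecPred_forall_lt hw <| primrecPred_exists_lt (hu.comp Primrec.fst) <|
      hR.comp ((hj.comp (Primrec.fst.comp Primrec.fst)).pair
        ((Primrec.snd.comp Primrec.fst).pair Primrec.snd))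
  have hget : Primrec₂ fun (l : List ℕ) j => l.getD j 0 := Primrec.list_getD 0
  have hgrown : ∀ {α : Type} [Primcodable α] {l : α → List ℕ} {w u : α → ℕ}, Primrec l →
      Primrec w → Primrec u → PrimrecPred fun p => Grown R (l p) (w p) (u p) := fun hl hw hu =>
    (Primrec.nat_le.comp hw hu).and <| primrecPred_forall_lt (Primrec.list_length.comp hl) <|
      primrecPred_imp (Primrec.eq.comp (hget.comp (hl.comp Primrec.fst) Primrec.snd)
        (Primrec.const 0)) (hprog Primrec.snd (hw.comp Primrec.fst) (hu.comp Primrec.fst))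
  have hl : Primrec fun s : ℕ => ofNat (List ℕ) s.unpair.1 :=
    (Primrec.ofNat _).comp (Primrec.fst.comp Primrec.unpair)
  have hw : Primrec fun s : ℕ => s.unpair.2.unpair.1 :=
    Primrec.fst.comp (Primrec.unpair.comp (Primrec.snd.comp Primrec.unpair))
  have hu : Primrec fun s : ℕ => s.unpair.2.unpair.2 :=
    Primrec.snd.comp (Primrec.unpair.comp (Primrec.snd.comp Primrec.unpair))
  refine Primrec.ite ((hgrown hl hw hu).and ((primrecPred_forall_lt hu
    (hgrown (hl.comp Primrec.fst) (hw.comp Primrec.fst) Primrec.snd).not).and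
    (primrecPred_forall_lt (Primrec.list_length.comp hl) (primrecPred_imp ?_ (.and ?_ (.not ?_))))))
    (Primrec.fst.comp Primrec.unpair) (Primrec.const 0)
  · exact (Primrec.eq.comp (hget.comp (hl.comp Primrec.fst) Primrec.snd) (Primrec.const 0)).not
  · exact hprog Primrec.snd (Primrec.pred.comp (hget.comp (hl.comp Primrec.fst) Primrec.snd))
      (hu.comp Primrec.fst)
  · exact hprog Primrec.snd (hget.comp (hl.comp Primrec.fst) Primrec.snd) (hu.comp Primrec.fst)

end Guesses

theorem exists_guessTree {S : ℕ → ℕ → Prop} (hS : Equivalence S) (h3 : IsSigma03 S) :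
    Nonempty (GuessTree S) := by
  classical
  obtain ⟨R, hR, hSR⟩ := h3.exists_primrec
  refine ⟨{
    visit := visitNode R
    len := fun n => (ofNat (List ℕ) n).length
    rep := fun n i => applySubst (substs (ofNat (List ℕ) n)) i
    ext := fun n m => ofNat (List ℕ) n <+: ofNat (List ℕ) m
    IsTrue := TrueNode R
    visit_primrec := visitNode_primrec hR
    len_primrec := Primrec.list_length.comp (Primrec.ofNat _)
    rep_primrec := applySubst_primrec.comp
      (substs_primrec.comp ((Primrec.ofNat _).comp Primrec.fst)) Primrec.snd
    ext_primrec := ?_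
    ext_trans := fun h h' => h.trans h'
    ext_of_lt := ?_
    visit_true := visitNode_of_true
    visit_false := visitNode_of_not_true
    exists_len := ?_
    rep_sound := ?_
    exists_rep_eq := ?_
    rep_eq_of_ext := fun h h' => applySubst_substs_of_prefix h h' }⟩
  · have h1 : Primrec fun p : ℕ × ℕ => ofNat (List ℕ) p.1 := (Primrec.ofNat _).comp Primrec.fst
    have h2 : Primrec fun p : ℕ × ℕ => ofNat (List ℕ) p.2 := (Primrec.ofNat _).comp Primrec.snd
    exact (Primrec.eq.comp h1 (Primrec.list_take.comp (Primrec.list_length.comp h1) h2)).of_eq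
      fun p => List.prefix_iff_eq_take.symm
  · intro n m hn hm hlt
    have hpre : ∀ {n m : ℕ}, TrueNode R n → TrueNode R m →
        (ofNat (List ℕ) n).length ≤ (ofNat (List ℕ) m).length →
        ofNat (List ℕ) n <+: ofNat (List ℕ) m := fun hn hm hle => by
      rw [hn, hm, List.prefix_iff_eq_take, ← List.map_take, List.take_range]
      simp [hle]
    rcases le_total (ofNat (List ℕ) n).length (ofNat (List ℕ) m).length with hle | hle
    · exact hpre hn hm hle
    · obtain ⟨r, hr⟩ := hpre hm hn hle
      have := encode_le_encode_append (ofNat (List ℕ) m) r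
      rw [hr, encode_ofNat, encode_ofNat] at this
      omega
  · intro k
    exact ⟨encode ((List.range k).map (trueGuess R)), by simp [TrueNode], by simp⟩
  · intro n hn i
    refine applySubst_sound hS _ (fun j hj h0 => ?_) i
    rw [← List.getD_eq_getElem _ 0 hj, trueNode_iff.1 hn j hj, trueGuess_eq_zero_iff,
      forall_exists_progress_iff] at h0
    rw [hSR]
    exact ⟨j.unpair.2, by simpa using h0⟩
  · intro y z hyz
    obtain ⟨a, ha⟩ := (hSR y z).1 hyz
    have h0 : trueGuess R (Nat.pair (Nat.pair y z) a) = 0 :=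
      trueGuess_eq_zero_iff.2 (forall_exists_progress_iff.2 ha)
    refine ⟨encode ((List.range (Nat.pair (Nat.pair y z) a + 1)).map (trueGuess R)),
      by simp [TrueNode], ?_⟩
    rw [ofNat_encode, List.range_succ, List.map_append, List.map_singleton, h0]
    exact applySubst_merge (a := a) (by simp)

/-! ### Cylinders -/

/-- The cylinder over `A`, shifted to have room for a column that is contained in it and one that is
disjoint from it. -/
def cylinder (A : Set ℕ) : Set ℕ :=
  {w | w.unpair.1 = 0 ∨ 2 ≤ w.unpair.1 ∧ w.unpair.1 - 2 ∈ A}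

/-- Cylinders of almost equal sets are one-one reducible to each other: the finitely many
exceptional columns are sent to the full and the empty column, according to a finite table. -/
theorem oneOneReducible_cylinder {A B : Set ℕ} {N : ℕ} (h : ∀ x ≥ N, x ∈ A ↔ x ∈ B) :
    OneOneReducible (fun w => w ∈ cylinder A) (fun w => w ∈ cylinder B) := by
  classical
  let table : List ℕ :=
    (List.range (N + 2)).map fun x => if x = 0 ∨ 2 ≤ x ∧ x - 2 ∈ A then 0 else 1
  let f : ℕ → ℕ := fun x => (table[x]?).getD x
  have hf : Primrec f :=
    Primrec.option_getD.comp (Primrec.list_getElem?₁ table) Primrec.id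
  refine ⟨fun w => Nat.pair (f w.unpair.1) w, Primrec.to_comp (Primrec₂.natPair.comp
    (hf.comp (Primrec.fst.comp Primrec.unpair)) Primrec.id), fun v w h => ?_, fun w => ?_⟩
  · exact (Nat.pair_eq_pair.1 h).2
  · simp only [cylinder, Set.mem_ofPred_eq, Nat.unpair_pair]
    generalize w.unpair.1 = x
    rcases lt_or_ge x (N + 2) with hx | hx
    · have hfx : f x = if x = 0 ∨ 2 ≤ x ∧ x - 2 ∈ A then 0 else 1 := by
        simp [f, table, hx]
      rw [hfx]
      split_ifs with hA <;> simp [hA]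
    · have hfx : f x = x := by
        have : table[x]? = Option.none := by simp [table]; omega
        simp [f, this]
      rw [hfx, h (x - 2) (by omega)]

theorem some_bind_charFun (A : Set ℕ) (n : ℕ) : (Part.some n >>= charFun A) = charFun A n :=
  Part.bind_some n _

theorem SetTuringReducible.of_manyOneReducible {A B : Set ℕ}
    (h : ManyOneReducible (fun n => n ∈ A) (fun n => n ∈ B)) : SetTuringReducible A B := by
  classical
  obtain ⟨f, hf, hAB⟩ := h
  refine RecursiveIn.iff_nat.2 ((Nat.RecursiveIn.comp (.oracle _ (Set.mem_singleton (charFun B)))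
    (Partrec.nat_iff.1 hf.partrec).recursiveIn).of_eq fun n => ?_)
  refine (some_bind_charFun B (f n)).trans ?_
  exact congrArg Part.some (if_congr (hAB n).symm rfl rfl)

theorem SetTuringReducible.trans {A B C : Set ℕ} (h : SetTuringReducible A B)
    (h' : SetTuringReducible B C) : SetTuringReducible A C :=
  TuringReducible.trans h h'

theorem setTuringReducible_cylinder (A : Set ℕ) : SetTuringReducible A (cylinder A) := by
  refine .of_manyOneReducible ⟨fun x => Nat.pair (x + 2) 0, Primrec.to_comp (Primrec₂.natPair.comp
    (Primrec.succ.comp Primrec.succ) (Primrec.const 0)), fun x => ?_⟩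
  simp [cylinder]

theorem cylinder_setTuringReducible (A : Set ℕ) : SetTuringReducible (cylinder A) A := by
  classical
  have h1 : Primrec fun w : ℕ => w.unpair.1 - 2 :=
    Primrec.nat_sub.comp (Primrec.fst.comp Primrec.unpair) (Primrec.const 2)
  have hx : Primrec fun q : ℕ => q.unpair.1.unpair.1 :=
    Primrec.fst.comp (Primrec.unpair.comp (Primrec.fst.comp Primrec.unpair))
  have h2 : Primrec fun q : ℕ => if q.unpair.1.unpair.1 = 0 then 1 else
      if 2 ≤ q.unpair.1.unpair.1 then q.unpair.2 else 0 :=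
    Primrec.ite (Primrec.eq.comp hx (Primrec.const 0)) (Primrec.const 1)
      (Primrec.ite (Primrec.nat_le.comp (Primrec.const 2) hx) (Primrec.snd.comp Primrec.unpair)
        (Primrec.const 0))
  refine RecursiveIn.iff_nat.2 ((Nat.RecursiveIn.comp (Primrec.nat_iff.1 h2).recursiveIn
    (Nat.RecursiveIn.pair (Primrec.nat_iff.1 Primrec.id).recursiveIn
      (Nat.RecursiveIn.comp (.oracle _ (Set.mem_singleton (charFun A)))
        (Primrec.nat_iff.1 h1).recursiveIn))).of_eq fun w => ?_)
  by_cases h0 : w.unpair.1 = 0 <;> by_cases h2 : 2 ≤ w.unpair.1 <;>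
    simp [Seq.seq, some_bind_charFun, charFun, cylinder, h0, h2]

/-- A uniformly c.e. family of sets which are almost equal for `S`-equivalent indices and
Turing incomparable for inequivalent ones becomes, by passing to cylinders, an injective reduction. -/
theorem exists_injective_reduction {S : ℕ → ℕ → Prop} (hS : Equivalence S) (h3 : IsSigma03 S) :
    ∃ g : ℕ → ℕ, Computable g ∧ Function.Injective g ∧ ∀ y z,
      (S y z → SetOneOneEquiv (W (g y)) (W (g z))) ∧
      (¬ S y z → TuringIncomparable (W (g y)) (W (g z))) := by
  obtain ⟨T⟩ := exists_guessTree hS h3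
  have hx : Primrec fun p : ℕ × ℕ × ℕ => p.2.1.unpair.1 :=
    Primrec.fst.comp (Primrec.unpair.comp (Primrec.fst.comp Primrec.snd))
  obtain ⟨g, hg, hinj, hW⟩ := exists_injective_index
    (P := fun i w s => w.unpair.1 = 0 ∨ 2 ≤ w.unpair.1 ∧ T.InSet T.act i (w.unpair.1 - 2) s)
    ((Primrec.eq.comp hx (Primrec.const 0)).or ((Primrec.nat_le.comp (Primrec.const 2) hx).and
      (T.set_primrec.comp (Primrec.fst.pair ((Primrec.nat_sub.comp hx (Primrec.const 2)).pair
        (Primrec.snd.comp Primrec.snd))))))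
  have hcyl : ∀ i, W (g i) = cylinder (T.set i) := fun i => by
    rw [hW]
    ext w
    simp only [cylinder, GuessTree.set, Set.mem_ofPred_eq, exists_or, exists_const,
      exists_and_left]
  have hinc : ∀ y z, ¬ S y z → ¬ SetTuringReducible (W (g y)) (W (g z)) := fun y z hyz h => by
    rw [hcyl, hcyl] at h
    obtain ⟨e, he⟩ := (((setTuringReducible_cylinder _).trans h).trans
      (cylinder_setTuringReducible _)).exists_code
    exact T.not_enumerates hS hyz e he
  refine ⟨g, hg, hinj, fun y z => ⟨fun hyz => ?_, fun hyz => ⟨hinc y z hyz, hinc z y fun h =>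
    hyz (hS.symm h)⟩⟩⟩
  obtain ⟨N, hN⟩ := T.set_almost_eq hyz
  unfold SetOneOneEquiv
  rw [hcyl, hcyl]
  exact ⟨oneOneReducible_cylinder hN, oneOneReducible_cylinder fun x hx => (hN x hx).symm⟩

/-! ### Many-one and one-one equivalence of c.e. sets are `Σ⁰₃` -/

/-- The result of program `e` at `n` after `k` steps. -/
def run (e k n : ℕ) : Option ℕ := Code.evaln k (ofNat Code e) n

/-- Within `c` steps, the program `e` halts at `n`, and the elements among `n` and its image `v`
that enter `W x` and `W y`, respectively, within `s` steps are matched by `v ∈ W y` and `n ∈ W x`. -/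
def RedMatrix (e x y n s c : ℕ) : Prop :=
  (run e c n).isSome ∧
    ((run x s n).isSome → (run y c ((run e c n).getD 0)).isSome) ∧
    ((run y s ((run e c n).getD 0)).isSome → (run x c n).isSome)

/-- Within `c` steps, the program `e` is seen not to violate injectivity at `n` and `m`. -/
def InjMatrix (e n m c : ℕ) : Prop :=
  (run e c n).isSome ∧ (run e c m).isSome ∧
    ((run e c n).getD 0 = (run e c m).getD 0 → n = m)

theorem exists_isSome_run {e n : ℕ} : (∃ k, (run e k n).isSome) ↔ n ∈ W e := by
  simp only [W, Set.mem_ofPred_eq, Part.dom_iff_mem, Code.evaln_complete, run,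
    Option.isSome_iff_exists, Option.mem_def]
  exact exists_comm

theorem run_isSome_mono {e k k' n : ℕ} (h : k ≤ k') (hk : (run e k n).isSome) :
    (run e k' n).isSome := by
  obtain ⟨v, hv⟩ := Option.isSome_iff_exists.1 hk
  exact Option.isSome_iff_exists.2 ⟨v, Code.evaln_mono h hv⟩

theorem run_getD {e k n v : ℕ} (hv : v ∈ (ofNat Code e).eval n) (hk : (run e k n).isSome) :
    (run e k n).getD 0 = v := by
  obtain ⟨w, hw⟩ := Option.isSome_iff_exists.1 hk
  rw [hw, Option.getD_some]
  exact Part.mem_unique (Code.evaln_sound hw) hv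

theorem exists_redMatrix_iff {e x y : ℕ} : (∀ n s, ∃ c, RedMatrix e x y n s c) ↔
    ∃ f : ℕ → ℕ, (∀ n, f n ∈ (ofNat Code e).eval n) ∧ ∀ n, n ∈ W x ↔ f n ∈ W y := by
  constructor
  · intro h
    have hdom : ∀ n, ((ofNat Code e).eval n).Dom := fun n => by
      obtain ⟨c, hc, -⟩ := h n 0
      exact exists_isSome_run.1 ⟨c, hc⟩
    choose f hf using fun n => Part.dom_iff_mem.1 (hdom n)
    refine ⟨f, hf, fun n => ?_⟩
    constructor
    · intro hn
      obtain ⟨s, hs⟩ := exists_isSome_run.2 hn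
      obtain ⟨c, hc, h1, -⟩ := h n s
      exact exists_isSome_run.1 ⟨c, run_getD (hf n) hc ▸ h1 hs⟩
    · intro hn
      obtain ⟨s, hs⟩ := exists_isSome_run.2 hn
      obtain ⟨c, hc, -, h2⟩ := h n s
      exact exists_isSome_run.1 ⟨c, h2 (by rwa [run_getD (hf n) hc])⟩
  · rintro ⟨f, hf, h⟩ n s
    obtain ⟨k, hk⟩ := Code.evaln_complete.1 (hf n)
    have hk : (run e k n).isSome := Option.isSome_iff_exists.2 ⟨_, hk⟩
    have hex : ∃ c, n ∈ W x → (run x c n).isSome ∧ (run y c (f n)).isSome := by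
      by_cases hn : n ∈ W x
      · obtain ⟨c₁, h₁⟩ := exists_isSome_run.2 hn
        obtain ⟨c₂, h₂⟩ := exists_isSome_run.2 ((h n).1 hn)
        exact ⟨max c₁ c₂, fun _ => ⟨run_isSome_mono (le_max_left _ _) h₁,
          run_isSome_mono (le_max_right _ _) h₂⟩⟩
      · exact ⟨0, fun h => absurd h hn⟩
    obtain ⟨c, hc⟩ := hex
    have hkc := run_isSome_mono (le_max_left k c) hk
    refine ⟨max k c, hkc, ?_, ?_⟩ <;> rw [run_getD (hf n) hkc] <;> intro hs
    · exact run_isSome_mono (le_max_right _ _) (hc (exists_isSome_run.1 ⟨s, hs⟩)).2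
    · exact run_isSome_mono (le_max_right _ _) (hc ((h n).2 (exists_isSome_run.1 ⟨s, hs⟩))).1

theorem exists_injMatrix_iff {e : ℕ} {f : ℕ → ℕ} (hf : ∀ n, f n ∈ (ofNat Code e).eval n) :
    (∀ n m, ∃ c, InjMatrix e n m c) ↔ Function.Injective f := by
  constructor
  · intro h n m hnm
    obtain ⟨c, hn, hm, hc⟩ := h n m
    rw [run_getD (hf n) hn, run_getD (hf m) hm] at hc
    exact hc hnm
  · intro h n m
    obtain ⟨k, hk⟩ := Code.evaln_complete.1 (hf n)
    obtain ⟨k', hk'⟩ := Code.evaln_complete.1 (hf m)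
    have hn : (run e (max k k') n).isSome :=
      run_isSome_mono (le_max_left _ _) (Option.isSome_iff_exists.2 ⟨_, hk⟩)
    have hm : (run e (max k k') m).isSome :=
      run_isSome_mono (le_max_right _ _) (Option.isSome_iff_exists.2 ⟨_, hk'⟩)
    refine ⟨max k k', hn, hm, ?_⟩
    rw [run_getD (hf n) hn, run_getD (hf m) hm]
    exact fun h' => h h'

theorem exists_code_of_computable {f : ℕ → ℕ} (hf : Computable f) :
    ∃ e : ℕ, ∀ n, f n ∈ (ofNat Code e).eval n := by
  obtain ⟨c, hc⟩ := Code.exists_code.1 (Partrec.nat_iff.1 hf.partrec)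
  exact ⟨encode c, fun n => by simp [hc]⟩

theorem computable_of_code {e : ℕ} {f : ℕ → ℕ} (hf : ∀ n, f n ∈ (ofNat Code e).eval n) :
    Computable f :=
  Partrec.of_eq_tot (Partrec.nat_iff.2 (Code.exists_code.2 ⟨_, rfl⟩)) hf

theorem manyOneReducible_W_iff {x y : ℕ} :
    ManyOneReducible (fun n => n ∈ W x) (fun n => n ∈ W y) ↔
      ∃ e, ∀ b : ℕ, ∃ c, RedMatrix e x y b.unpair.1 b.unpair.2 c := by
  constructor
  · rintro ⟨f, hf, h⟩
    obtain ⟨e, he⟩ := exists_code_of_computable hf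
    exact ⟨e, fun b => exists_redMatrix_iff.2 ⟨f, he, h⟩ _ _⟩
  · rintro ⟨e, he⟩
    obtain ⟨f, hf, h⟩ := exists_redMatrix_iff.1 fun n s => by simpa using he (Nat.pair n s)
    exact ⟨f, computable_of_code hf, h⟩

theorem oneOneReducible_W_iff {x y : ℕ} :
    OneOneReducible (fun n => n ∈ W x) (fun n => n ∈ W y) ↔
      ∃ e, ∀ b : ℕ, ∃ c : ℕ, RedMatrix e x y b.unpair.1 b.unpair.2 c.unpair.1 ∧
        InjMatrix e b.unpair.1 b.unpair.2 c.unpair.2 := by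
  constructor
  · rintro ⟨f, hf, hinj, h⟩
    obtain ⟨e, he⟩ := exists_code_of_computable hf
    refine ⟨e, fun b => ?_⟩
    obtain ⟨c, hc⟩ := exists_redMatrix_iff.2 ⟨f, he, h⟩ b.unpair.1 b.unpair.2
    obtain ⟨c', hc'⟩ := (exists_injMatrix_iff he).2 hinj b.unpair.1 b.unpair.2
    exact ⟨Nat.pair c c', by simpa using ⟨hc, hc'⟩⟩
  · rintro ⟨e, he⟩
    have he' : ∀ n s, ∃ c : ℕ, RedMatrix e x y n s c.unpair.1 ∧ InjMatrix e n s c.unpair.2 :=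
      fun n s => by simpa using he (Nat.pair n s)
    obtain ⟨f, hf, h⟩ := exists_redMatrix_iff.1 fun n s =>
      let ⟨c, hc, _⟩ := he' n s
      ⟨_, hc⟩
    exact ⟨f, computable_of_code hf, (exists_injMatrix_iff hf).1 fun n m =>
      let ⟨c, _, hc⟩ := he' n m
      ⟨_, hc⟩, h⟩

section Primrec

variable {α : Type*} [Primcodable α] {e x y n m s c : α → ℕ}

theorem run_primrec (he : Primrec e) (hs : Primrec s) (hn : Primrec n) :
    Primrec fun p => run (e p) (s p) (n p) :=
  Code.primrec_evaln.comp ((hs.pair ((Primrec.ofNat Code).comp he)).pair hn)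

theorem isSome_run_primrec (he : Primrec e) (hs : Primrec s) (hn : Primrec n) :
    PrimrecPred fun p => ((run (e p) (s p) (n p)).isSome : Prop) :=
  Primrec.eq.comp (Primrec.option_isSome.comp (run_primrec he hs hn)) (Primrec.const true)

theorem getD_run_primrec (he : Primrec e) (hs : Primrec s) (hn : Primrec n) :
    Primrec fun p => (run (e p) (s p) (n p)).getD 0 :=
  Primrec.option_getD.comp (run_primrec he hs hn) (Primrec.const 0)

theorem redMatrix_primrec (he : Primrec e) (hx : Primrec x) (hy : Primrec y) (hn : Primrec n)
    (hs : Primrec s) (hc : Primrec c) :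
    PrimrecPred fun p => RedMatrix (e p) (x p) (y p) (n p) (s p) (c p) :=
  (isSome_run_primrec he hc hn).and <| (primrecPred_imp (isSome_run_primrec hx hs hn)
    (isSome_run_primrec hy hc (getD_run_primrec he hc hn))).and <|
    primrecPred_imp (isSome_run_primrec hy hs (getD_run_primrec he hc hn))
      (isSome_run_primrec hx hc hn)

theorem injMatrix_primrec (he : Primrec e) (hn : Primrec n) (hm : Primrec m) (hc : Primrec c) :
    PrimrecPred fun p => InjMatrix (e p) (n p) (m p) (c p) :=
  (isSome_run_primrec he hc hn).and <| (isSome_run_primrec he hc hm).and <|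
    primrecPred_imp (Primrec.eq.comp (getD_run_primrec he hc hn) (getD_run_primrec he hc hm))
      (Primrec.eq.comp hn hm)

end Primrec

/-- The symmetric part of a `Σ⁰₃` relation is `Σ⁰₃`. -/
theorem isSigma03_symm {E : ℕ → ℕ → Prop} {M : ℕ → ℕ → ℕ → ℕ → ℕ → Prop}
    (hM : ∀ {e x y b c : ℕ × ℕ × ℕ × ℕ × ℕ → ℕ}, Primrec e → Primrec x → Primrec y → Primrec b →
      Primrec c → PrimrecPred fun p => M (e p) (x p) (y p) (b p) (c p))
    (hE : ∀ x y, E x y ↔ (∃ e, ∀ b, ∃ c, M e x y b c) ∧ ∃ e, ∀ b, ∃ c, M e y x b c) :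
    IsSigma03 E := by
  have hx : Primrec fun p : ℕ × ℕ × ℕ × ℕ × ℕ => p.1 := Primrec.fst
  have hy : Primrec fun p : ℕ × ℕ × ℕ × ℕ × ℕ => p.2.1 := Primrec.fst.comp Primrec.snd
  have ha : Primrec fun p : ℕ × ℕ × ℕ × ℕ × ℕ => p.2.2.1.unpair :=
    Primrec.unpair.comp (Primrec.fst.comp (Primrec.snd.comp Primrec.snd))
  have hb : Primrec fun p : ℕ × ℕ × ℕ × ℕ × ℕ => p.2.2.2.1 :=
    Primrec.fst.comp (Primrec.snd.comp (Primrec.snd.comp Primrec.snd))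
  have hc : Primrec fun p : ℕ × ℕ × ℕ × ℕ × ℕ => p.2.2.2.2.unpair :=
    Primrec.unpair.comp (Primrec.snd.comp (Primrec.snd.comp (Primrec.snd.comp Primrec.snd)))
  refine ⟨fun p => M p.2.2.1.unpair.1 p.1 p.2.1 p.2.2.2.1 p.2.2.2.2.unpair.1 ∧
    M p.2.2.1.unpair.2 p.2.1 p.1 p.2.2.2.1 p.2.2.2.2.unpair.2,
    ((hM (Primrec.fst.comp ha) hx hy hb (Primrec.fst.comp hc)).and
      (hM (Primrec.snd.comp ha) hy hx hb (Primrec.snd.comp hc))).computablePred, fun x y => ?_⟩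
  rw [hE]
  constructor
  · rintro ⟨⟨e, he⟩, e', he'⟩
    refine ⟨Nat.pair e e', fun b => ?_⟩
    obtain ⟨c, hc⟩ := he b
    obtain ⟨c', hc'⟩ := he' b
    exact ⟨Nat.pair c c', by simpa using ⟨hc, hc'⟩⟩
  · rintro ⟨a, ha⟩
    exact ⟨⟨a.unpair.1, fun b => (ha b).elim fun c hc => ⟨c.unpair.1, hc.1⟩⟩,
      a.unpair.2, fun b => (ha b).elim fun c hc => ⟨c.unpair.2, hc.2⟩⟩

theorem isSigma03_manyOneEquiv : IsSigma03 fun x y => SetManyOneEquiv (W x) (W y) :=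
  isSigma03_symm (M := fun e x y b c => RedMatrix e x y b.unpair.1 b.unpair.2 c)
    (fun he hx hy hb hc => redMatrix_primrec he hx hy (Primrec.fst.comp (Primrec.unpair.comp hb))
      (Primrec.snd.comp (Primrec.unpair.comp hb)) hc)
    fun _ _ => and_congr manyOneReducible_W_iff manyOneReducible_W_iff

theorem isSigma03_oneOneEquiv : IsSigma03 fun x y => SetOneOneEquiv (W x) (W y) :=
  isSigma03_symm (M := fun e x y b c => RedMatrix e x y b.unpair.1 b.unpair.2 c.unpair.1 ∧
      InjMatrix e b.unpair.1 b.unpair.2 c.unpair.2)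
    (fun he hx hy hb hc =>
      have hb1 := Primrec.fst.comp (Primrec.unpair.comp hb)
      have hb2 := Primrec.snd.comp (Primrec.unpair.comp hb)
      have hc := Primrec.unpair.comp hc
      (redMatrix_primrec he hx hy hb1 hb2 (Primrec.fst.comp hc)).and
        (injMatrix_primrec he hb1 hb2 (Primrec.snd.comp hc)))
    fun _ _ => and_congr oneOneReducible_W_iff oneOneReducible_W_iff

end CERel

theorem mainTheorem4 :
    (∀ S : ℕ → ℕ → Prop, Equivalence S → CERel.IsSigma03 S →
      ∃ g : ℕ → ℕ, Computable g ∧ ∀ y z,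
        (S y z → CERel.SetOneOneEquiv (CERel.W (g y)) (CERel.W (g z))) ∧
        (¬ S y z → CERel.TuringIncomparable (CERel.W (g y)) (CERel.W (g z)))) ∧
    CERel.IsSigma03CompleteEqRel
      (fun x y => CERel.SetManyOneEquiv (CERel.W x) (CERel.W y)) ∧
    CERel.IsSigma03CompleteEqRel
      (fun x y => CERel.SetOneOneEquiv (CERel.W x) (CERel.W y)) := by
  refine ⟨fun S hS h3 => ?_, ⟨?_, CERel.isSigma03_manyOneEquiv, fun S hS h3 => ?_⟩,
    ⟨?_, CERel.isSigma03_oneOneEquiv, fun S hS h3 => ?_⟩⟩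
  · obtain ⟨g, hg, -, h⟩ := CERel.exists_injective_reduction hS h3
    exact ⟨g, hg, h⟩
  · exact equivalence_of_manyOneEquiv.comap fun x n => n ∈ CERel.W x
  · obtain ⟨g, hg, hinj, h⟩ := CERel.exists_injective_reduction hS h3
    refine ⟨g, hg, hinj, fun y z => ⟨fun hyz => ((h y z).1 hyz).to_many_one, fun hm => ?_⟩⟩
    by_contra hyz
    exact ((h y z).2 hyz).1 (.of_manyOneReducible hm.1)
  · exact equivalence_of_oneOneEquiv.comap fun x n => n ∈ CERel.W x
  · obtain ⟨g, hg, hinj, h⟩ := CERel.exists_injective_reduction hS h3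
    refine ⟨g, hg, hinj, fun y z => ⟨(h y z).1, fun ho => ?_⟩⟩
    by_contra hyz
    exact ((h y z).2 hyz).1 (.of_manyOneReducible ho.1.to_many_one)
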